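/- **Setting.** Let $\mathcal X$ be a standard Borel space (for instance a Borel subset of $\mathbb R^d$) and $\Lambda\in[1,\infty)$. The full data are $O=(X,Y(1),Y(0),A,U)$ with $X\in\mathcal X$, real potential outcomes $Y(1),Y(0)$, treatment $A\in\{0,1\}$ and an unobserved confounder $U$ with values in some $\mathbb R^m$; the observed data are $Z=(X,Y,A)$ with $Y=Y(A)$. A law $Q$ of $O$ satisfies the *marginal sensitivity model* $\mathrm{MSM}(\Lambda)$ if under $Q$ the pair $(Y(1),Y(0))$ is independent of $A$ given $(X,U)$, the scores $Q(A=1\mid X,U)$ and $Q(A=1\mid X)$ lie in $(0,1)$ almost surely, and $$\frac1\Lambda\le\frac{Q(A=1\mid X,U)/Q(A=0\mid X,U)}{Q(A=1\mid X)/Q(A=0\mid X)}\le\Lambda\qquad Q\text{-a.s.}$$ Let $P_o$ be a law of $O$ satisfying $\mathrm{MSM}(\Lambda)$ with $\mathbb E_{P_o}|Y(a)|<\infty$ for $a=0,1$, and let $P$ be the law of $Z$ that it induces; $\mathbb E$ denotes expectation under $P$. For $k\ge1$ let $\mathcal P(\Lambda)$ be the set of all laws $Q$ of $(X,Y(1),Y(0),A,U)$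 with $U\in\mathbb R^k$ that satisfy $\mathrm{MSM}(\Lambda)$ and induce the law $P$ of $(X,Y,A)$. For a measurable policy $\pi:\mathcal X\to[0,1]$ put $Y(\pi(X))=\pi(X)Y(1)+(1-\pi(X))Y(0)$, $\pi(1|x)=\pi(x)$, $\pi(0|x)=1-\pi(x)$ and $$W_\Lambda(\pi)=\inf_{Q\in\mathcal P(\Lambda)}\mathbb E_Q[Y(\pi(X))].$$ Let $e(x)=P(A=1\mid X=x)$, let $F(\cdot|x,a)$ be the conditional distribution function of $Y$ given $X=x,A=a$, let $q^-(x,a)=\inf\{q:F(q|x,a)\ge\frac1{1+\Lambda}\}$, $\rho^-_1(x,a)=\mathbb E[Y\mathbf 1\{Y<q^-(X,A)\}\mid X=x,A=a]$ and $\rho^-_0(x,a)=\mathbb E[Y\mathbf 1\{Y>q^-(X,A)\}\mid X=x,A=a]$. For a tuple of functions $\eta=(e,q^-,\rho^-_1,\rho^-_0)$ put $e_1=e$, $e_0=1-e$, and, with $\operatorname{sgn}(s)=1$ for $s\ge0$ and $-1$ otherwise, for $z=(x,y,a)$, $$\begin{aligned}\phi^-_t(z;\eta)=\;&y\mathbf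 1\{a=t\}\Big[1+\tfrac{1-e_t(x)}{e_t(x)}\Lambda^{-\operatorname{sgn}(y-q^-(x,t))}\Big]\\&+q^-(x,t)\mathbf 1\{a=t\}\tfrac{1-e_t(x)}{e_t(x)}(\Lambda-\Lambda^{-1})\Big[\tfrac1{1+\Lambda}-\mathbf 1\{y<q^-(x,t)\}\Big]\\&-\tfrac1{e_t(x)}\big[\Lambda\rho^-_1(x,t)+\Lambda^{-1}\rho^-_0(x,t)\big]\big[\mathbf 1\{a=t\}-e_t(x)\big],\end{aligned}$$ and $\psi_W(z,\pi;\eta)=\sum_{t\in\{0,1\}}\phi^-_t(z;\eta)\,\pi(t|x)$. **Proposition.** Let $\pi:\mathcal X\to[0,1]$ be any measurable policy and let $\eta$ be the tuple of true nuisance functions. 1. $\mathcal P(\Lambda)$ is non-empty, $Y(\pi(X))$ is $Q$-integrable for every $Q\in\mathcal P(\Lambda)$, the infimum defining $W_\Lambda(\pi)$ is finite, $\psi_W(Z,\pi;\eta)$ is integrable, and $\mathbb E[\psi_W(Z,\pi;\eta)]=W_\Lambda(\pi)$. 2. Suppose that for $P$-almost every $(x,a)$ the function $F(\cdot|x,a)$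 is continuous at $q^-(x,a)$. Let $\widetilde\eta=(\widetilde e,\widetilde q^-,\widetilde\rho^-_1,\widetilde\rho^-_0)$ be measurable with $\widetilde e:\mathcal X\to(0,1)$ and $\widetilde q^-,\widetilde\rho^-_1,\widetilde\rho^-_0:\mathcal X\times\{0,1\}\to\mathbb R$ such that $\widetilde q^-(X,a)$, $\widetilde\rho^-_1(X,a)$, $\widetilde\rho^-_0(X,a)$ are integrable for $a=0,1$. Then $\psi_W(Z,\pi;\eta+r(\widetilde\eta-\eta))$ is integrable for all $r\in[0,1)$ and $$\frac{\mathrm d}{\mathrm dr}\,\mathbb E\big[\psi_W(Z,\pi;\eta+r(\widetilde\eta-\eta))\big]\Big|_{r=0}=0,$$ the derivative at $0$ being taken along the segment $r\ge0$ from $\eta$ to $\widetilde\eta$. If moreover $e(X)+r(\widetilde e(X)-e(X))\in(0,1)$ almost surely for every $r$ in a neighbourhood of $0$ (for example if $\kappa<e(x)<1-\kappa$ for all $x$ and some $\kappa>0$), then the integrand is integrable for all $r$ near $0$ and the two-sided derivative at $r=0$ exists and equals $0$. -/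

import Mathlib

open MeasureTheory ProbabilityTheory Filter Topology

noncomputable section

namespace RobustPolicy

/-- The observed data `Z = (X, Y, A)`: covariates, outcome, treatment (`true` is `A = 1`). -/
abbrev Obs (𝒳 : Type*) := 𝒳 × ℝ × Bool

/-- The full counterfactual data `O = (X, Y(1), Y(0), A, U)` with `U ∈ ℝ ^ k`. -/
abbrev Full (𝒳 : Type*) (k : ℕ) := 𝒳 × ℝ × ℝ × Bool × (Fin k → ℝ)

namespace Full

variable {𝒳 : Type*} {k : ℕ}

/-- The covariates `X`. -/
def X (o : Full 𝒳 k) : 𝒳 := o.1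

/-- The potential outcome `Y(a)`. -/
def pot (a : Bool) (o : Full 𝒳 k) : ℝ := if a then o.2.1 else o.2.2.1

/-- The treatment `A`. -/
def A (o : Full 𝒳 k) : Bool := o.2.2.2.1

/-- The unobserved confounder `U`. -/
def U (o : Full 𝒳 k) : Fin k → ℝ := o.2.2.2.2

/-- The pair `(X, U)`. -/
def XU (o : Full 𝒳 k) : 𝒳 × (Fin k → ℝ) := (o.X, o.U)

/-- The observed data `(X, Y, A)` with `Y = Y(A)`. -/
def obs (o : Full 𝒳 k) : Obs 𝒳 := (o.X, pot o.A o, o.A)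

/-- The outcome under a policy, `Y(π(X)) = π(X) Y(1) + (1 - π(X)) Y(0)`. -/
def policyOutcome (π : 𝒳 → ℝ) (o : Full 𝒳 k) : ℝ :=
  π o.X * pot true o + (1 - π o.X) * pot false o

variable [MeasurableSpace 𝒳]

lemma measurable_XU : Measurable (XU : Full 𝒳 k → 𝒳 × (Fin k → ℝ)) := by
  unfold XU X U
  fun_prop

end Full

section MSM

variable {𝒳 : Type*} [MeasurableSpace 𝒳] {k : ℕ}

/-- The odds `p / (1 - p)`. -/
def odds (p : ℝ) : ℝ := p / (1 - p)

/-- The true propensity score `Q(A = 1 | X = x, U = u)`. -/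
def truePropensity (Q : Measure (Full 𝒳 k)) [IsFiniteMeasure Q] (xu : 𝒳 × (Fin k → ℝ)) : ℝ :=
  (condDistrib Full.A Full.XU Q xu).real {true}

/-- The nominal propensity score `Q(A = 1 | X = x)` under a law of the full data. -/
def fullNominalPropensity (Q : Measure (Full 𝒳 k)) [IsFiniteMeasure Q] (x : 𝒳) : ℝ :=
  (condDistrib Full.A Full.X Q x).real {true}

/-- The marginal sensitivity model with parameter `Λ`: given `(X, U)` the pair of potential
outcomes is independent of `A`, and almost surely the odds ratio of the true and the nominal
propensity score lies in `[1/Λ, Λ]`. In Lean `p / 0 = 0`, so the lower bound `1/Λ > 0` fails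
wherever one of the two propensity scores is `0` or `1`; thus, as in the usual reading
of the odds ratio, both scores lie in `(0, 1)` almost surely. -/
structure IsMSM [StandardBorelSpace 𝒳] (Λ : ℝ) (Q : Measure (Full 𝒳 k)) [IsFiniteMeasure Q] :
    Prop where
  condIndep : CondIndepFun (MeasurableSpace.comap Full.XU inferInstance)
    Full.measurable_XU.comap_le
    (fun o : Full 𝒳 k => (Full.pot true o, Full.pot false o)) Full.A Q
  oddsRatio : ∀ᵐ o ∂Q,
    1 / Λ ≤ odds (truePropensity Q (Full.XU o)) / odds (fullNominalPropensity Q (Full.X o)) ∧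
    odds (truePropensity Q (Full.XU o)) / odds (fullNominalPropensity Q (Full.X o)) ≤ Λ

/-- The uncertainty set `𝒫(Λ)`: the laws of the full data, with a confounder in `ℝ ^ k`, that
satisfy the marginal sensitivity model and induce the observed-data law `P`. -/
def uncertaintySet [StandardBorelSpace 𝒳] (k : ℕ) (Λ : ℝ) (P : Measure (Obs 𝒳)) :
    Set (Measure (Full 𝒳 k)) :=
  {Q | ∃ _ : IsProbabilityMeasure Q, IsMSM Λ Q ∧ Q.map Full.obs = P}

/-- The worst-case welfare `W_Λ(π) = inf_{Q ∈ 𝒫(Λ)} E_Q[Y(π(X))]`. -/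
def worstCaseWelfare [StandardBorelSpace 𝒳] (k : ℕ) (Λ : ℝ) (P : Measure (Obs 𝒳)) (π : 𝒳 → ℝ) :
    ℝ :=
  sInf ((fun Q : Measure (Full 𝒳 k) => ∫ o, Full.policyOutcome π o ∂Q) '' uncertaintySet k Λ P)

end MSM

section Score

variable {𝒳 : Type*}

/-- A tuple `η = (e, q⁻, ρ⁻₁, ρ⁻₀)` of nuisance functions. -/
@[ext]
structure Nuisance (𝒳 : Type*) where
  /-- the propensity score `e(x)` -/
  e : 𝒳 → ℝ
  /-- the quantile function `q⁻(x, a)` -/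
  q : 𝒳 → Bool → ℝ
  /-- the lower truncated mean `ρ⁻₁(x, a)` -/
  rho1 : 𝒳 → Bool → ℝ
  /-- the upper truncated mean `ρ⁻₀(x, a)` -/
  rho0 : 𝒳 → Bool → ℝ

/-- The componentwise path `η + r (η' - η)`. -/
def Nuisance.path (η η' : Nuisance 𝒳) (r : ℝ) : Nuisance 𝒳 where
  e x := η.e x + r * (η'.e x - η.e x)
  q x a := η.q x a + r * (η'.q x a - η.q x a)
  rho1 x a := η.rho1 x a + r * (η'.rho1 x a - η.rho1 x a)
  rho0 x a := η.rho0 x a + r * (η'.rho0 x a - η.rho0 x a)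

/-- `e_t(x)`: `e_1 = e` and `e_0 = 1 - e`. -/
def Nuisance.eT (η : Nuisance 𝒳) (t : Bool) (x : 𝒳) : ℝ := if t then η.e x else 1 - η.e x

/-- The sign function with the convention `sgn 0 = 1`. -/
def sgn (s : ℝ) : ℤ := if 0 ≤ s then 1 else -1

/-- The indicator `1{a = t}` of a treatment arm. -/
def arm (t a : Bool) : ℝ := if a = t then 1 else 0

/-- The indicator `1{y < c}`. -/
def below (y c : ℝ) : ℝ := if y < c then 1 else 0

/-- The score `φ⁻_t(z; η)`, for `z = (x, y, a)`. -/
def phi (Λ : ℝ) (t : Bool) (z : Obs 𝒳) (η : Nuisance 𝒳) : ℝ :=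
  z.2.1 * arm t z.2.2 *
      (1 + (1 - η.eT t z.1) / η.eT t z.1 * Λ ^ (-sgn (z.2.1 - η.q z.1 t)))
    + η.q z.1 t * arm t z.2.2 * ((1 - η.eT t z.1) / η.eT t z.1) * (Λ - Λ⁻¹) *
      (1 / (1 + Λ) - below z.2.1 (η.q z.1 t))
    - 1 / η.eT t z.1 * (Λ * η.rho1 z.1 t + Λ⁻¹ * η.rho0 z.1 t) * (arm t z.2.2 - η.eT t z.1)

/-- `π(t|x)`: the probability of arm `t` under the policy. -/
def policyProb (π : 𝒳 → ℝ) (t : Bool) (x : 𝒳) : ℝ := if t then π x else 1 - π x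

/-- The doubly robust score `ψ_W(z, π; η) = ∑_t φ⁻_t(z; η) π(t|x)`. -/
def psiW (Λ : ℝ) (z : Obs 𝒳) (π : 𝒳 → ℝ) (η : Nuisance 𝒳) : ℝ :=
  ∑ t : Bool, phi Λ t z η * policyProb π t z.1

end Score

section Truth

variable {𝒳 : Type*} [MeasurableSpace 𝒳]

/-- The conditional law of `Y` given `X = x` and `A = a` under the observed-data law. -/
def outcomeLaw (P : Measure (Obs 𝒳)) [IsFiniteMeasure P] (x : 𝒳) (a : Bool) : Measure ℝ :=
  condDistrib (fun z : Obs 𝒳 => z.2.1) (fun z : Obs 𝒳 => (z.1, z.2.2)) P (x, a)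

/-- The nominal propensity score `e(x) = P(A = 1 | X = x)`. -/
def nominalPropensity (P : Measure (Obs 𝒳)) [IsFiniteMeasure P] (x : 𝒳) : ℝ :=
  (condDistrib (fun z : Obs 𝒳 => z.2.2) (fun z : Obs 𝒳 => z.1) P x).real {true}

/-- The conditional quantile `q⁻_Λ(x, a) = inf {q | F(q|x,a) ≥ 1/(1+Λ)}`. -/
def lowerQuantile (Λ : ℝ) (P : Measure (Obs 𝒳)) [IsFiniteMeasure P] (x : 𝒳) (a : Bool) : ℝ :=
  sInf {c : ℝ | 1 / (1 + Λ) ≤ cdf (outcomeLaw P x a) c}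

/-- The true nuisance functions `η = (e, q⁻, ρ⁻₁, ρ⁻₀)`, where
`ρ⁻₁(x, t) = E[Y 1{Y < q⁻(X, A)} | X = x, A = t]` and
`ρ⁻₀(x, t) = E[Y 1{Y > q⁻(X, A)} | X = x, A = t]`. -/
def trueNuisance (Λ : ℝ) (P : Measure (Obs 𝒳)) [IsFiniteMeasure P] : Nuisance 𝒳 where
  e := nominalPropensity P
  q := lowerQuantile Λ P
  rho1 x t := ∫ y in Set.Iio (lowerQuantile Λ P x t), y ∂(outcomeLaw P x t)
  rho0 x t := ∫ y in Set.Ioi (lowerQuantile Λ P x t), y ∂(outcomeLaw P x t)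

/-- An alternative value `η'` of the nuisance functions, defining the direction `η' - η`: the
propensity component takes values in `(0, 1)`, all components are measurable, and the real-valued
ones have a finite mean over the covariates. -/
structure Nuisance.Admissible (P : Measure (Obs 𝒳)) (η' : Nuisance 𝒳) : Prop where
  e_mem : ∀ x, η'.e x ∈ Set.Ioo (0 : ℝ) 1
  measurable_e : Measurable η'.e
  measurable_q : ∀ a, Measurable fun x => η'.q x a
  measurable_rho1 : ∀ a, Measurable fun x => η'.rho1 x a
  measurable_rho0 : ∀ a, Measurable fun x => η'.rho0 x a
  integrable_q : ∀ a, Integrable (fun z : Obs 𝒳 => η'.q z.1 a) P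
  integrable_rho1 : ∀ a, Integrable (fun z : Obs 𝒳 => η'.rho1 z.1 a) P
  integrable_rho0 : ∀ a, Integrable (fun z : Obs 𝒳 => η'.rho0 z.1 a) P

end Truth

end RobustPolicy

end

noncomputable section

namespace RobustPolicy

/-! ### Restriction to a treatment arm as a change of density -/

section Arm

/-! Write e_t for `armProb`, s_t for `scoreProb` and q_t for the lower quantile of arm t.
Conditional independence given (X, U) turns the mean of a function of (X, U, Y(1), Y(0)) into a mean
over the arm A = t with weight 1/s_t. The sensitivity model confines 1/s_t - 1 to the interval from
Λ⁻¹(1/e_t - 1) to Λ(1/e_t - 1). After centring Y(t) at q_t, which costs only a function of X, the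
smallest value of such a weight times y - q_t is (1/e_t - 1) times `tilt`. Hence the policy-weighted
mean of Y(t) is `armValue`, which depends on P alone, plus the mean of a nonnegative `excess`
(`IsMSM.integral_policyProb_mul_pot`, `mul_tilt_le`). This gives the lower bound.

The bound is attained by a law with a binary confounder. Given U = t the odds of arm t are divided
by Λ, and given U ≠ t they are multiplied by Λ. The weights of U are chosen so that inside arm t the
event U = t has conditional probability 1/(1+Λ) for every value of X. So Y(t) can be drawn from the
lower tail of that mass of the arm's outcome law when U = t, and from the upper tail otherwise: the
tails mix back to the observed law. An atom at the quantile is split between the tails, so no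
continuity is needed. Each value of U is the low state of one arm and the high state of the other,
so both excesses vanish under the same law, whatever the policy (`isLeast_armValue`).

The score is linked to `armValue` by `weighted_add_correction`: outcome term and quantile correction
merge into `tilt` + q. Averaging over the treatment gives `meanScore`, in which ρ = Λρ₁ + Λ⁻¹ρ₀ is
multiplied by e_t/ẽ_t - 1. At the true propensity this factor is zero.

Orthogonality has three sources, one for each direction. Without an atom at q_t, `tilt` + q has
conditional mean ρ, which removes the propensity direction; its slope in q has conditional mean 1 -
ΛF(q) - Λ⁻¹(1 - F(q)) = 0, which removes the quantile direction; the ρ direction carries the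
vanishing factor e_t/ẽ_t - 1. Dominated convergence applies because `tilt` is Lipschitz in q and
e_t/ẽ_t stays bounded along the path. -/

lemma arm_eq_indicator {Ω : Type*} (A : Ω → Bool) (t : Bool) (g : Ω → ℝ) :
    (fun ω => arm t (A ω) * g ω) = (A ⁻¹' {t}).indicator g := by
  funext ω
  by_cases h : A ω = t <;> simp [arm, Set.indicator, h]

lemma arm_nonneg (t a : Bool) : 0 ≤ arm t a := by unfold arm; split_ifs <;> norm_num

variable {Ω V : Type*} [MeasurableSpace Ω] [MeasurableSpace V] {Q : Measure Ω} {ν : Measure V}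
  {f : Ω → V} {A : Ω → Bool} {t : Bool} {p : V → ℝ}

/-- Stated for an abstract density `p`, because it serves both the observed data, where `p` is the
nominal propensity, and the full data, where it is the true one. -/
lemma integrable_arm_mul_iff (hf : Measurable f) (hA : Measurable A) (hp : Measurable p)
    (hp0 : ∀ v, 0 ≤ p v)
    (H : (Q.restrict (A ⁻¹' {t})).map f = ν.withDensity fun v => ENNReal.ofReal (p v))
    {g : V → ℝ} (hg : Measurable g) :
    Integrable (fun ω => arm t (A ω) * g (f ω)) Q ↔ Integrable (fun v => p v * g v) ν := by
  rw [arm_eq_indicator A t fun ω => g (f ω), integrable_indicator_iff (hA (by simp)),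
    IntegrableOn]
  have h1 := integrable_map_measure (μ := Q.restrict (A ⁻¹' {t})) (f := f) (g := g)
    hg.aestronglyMeasurable hf.aemeasurable
  rw [show (fun ω => g (f ω)) = g ∘ f from rfl, ← h1, H,
    integrable_withDensity_iff_integrable_smul' (by fun_prop) (by simp)]
  simp [ENNReal.toReal_ofReal (hp0 _)]

lemma integral_arm_mul (hf : Measurable f) (hA : Measurable A) (hp : Measurable p)
    (hp0 : ∀ v, 0 ≤ p v)
    (H : (Q.restrict (A ⁻¹' {t})).map f = ν.withDensity fun v => ENNReal.ofReal (p v))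
    {g : V → ℝ} (hg : Measurable g) :
    ∫ ω, arm t (A ω) * g (f ω) ∂Q = ∫ v, p v * g v ∂ν := by
  rw [arm_eq_indicator A t fun ω => g (f ω), integral_indicator (hA (by simp)),
    ← integral_map (φ := f) (f := g) hf.aemeasurable hg.aestronglyMeasurable, H,
    integral_withDensity_eq_integral_toReal_smul (by fun_prop) (by simp)]
  simp [ENNReal.toReal_ofReal (hp0 _)]

/-- If `A` has conditional law `κ` given `f`, then on the event `A = t` the law of `f` has density
`κ · {t}`. -/
lemma map_restrict_arm_of_map_eq_compProd [IsFiniteMeasure Q] (hf : Measurable f)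
    (hA : Measurable A) {κ : Kernel V Bool} [IsMarkovKernel κ]
    (h : Q.map (fun ω => (f ω, A ω)) = Q.map f ⊗ₘ κ) :
    (Q.restrict (A ⁻¹' {t})).map f =
      (Q.map f).withDensity fun v => ENNReal.ofReal ((κ v).real {t}) := by
  ext s hs
  rw [Measure.map_apply hf hs, Measure.restrict_apply (hf hs), withDensity_apply _ hs]
  have h2 : f ⁻¹' s ∩ A ⁻¹' {t} = (fun ω => (f ω, A ω)) ⁻¹' (s ×ˢ {t}) := by
    ext; simp
  rw [h2, ← Measure.map_apply (by fun_prop) (hs.prod (by simp)), h,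
    Measure.compProd_apply_prod hs (by simp)]
  simp

end Arm

/-! ### Disintegration of the observed law along the arms -/

section Observed

variable {𝒳 : Type*} [MeasurableSpace 𝒳]

/-- The conditional law of `Y` given `X = x` and `A = t`, as a kernel in `x`. -/
def outcomeKernel (P : Measure (Obs 𝒳)) [IsFiniteMeasure P] (t : Bool) : Kernel 𝒳 ℝ :=
  (condDistrib (fun z : Obs 𝒳 => z.2.1) (fun z : Obs 𝒳 => (z.1, z.2.2)) P).comap
    (fun x => (x, t)) (by fun_prop)

instance (P : Measure (Obs 𝒳)) [IsFiniteMeasure P] (t : Bool) :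
    IsMarkovKernel (outcomeKernel P t) := by
  unfold outcomeKernel; infer_instance

lemma outcomeKernel_apply (P : Measure (Obs 𝒳)) [IsFiniteMeasure P] (t : Bool) (x : 𝒳) :
    outcomeKernel P t x = outcomeLaw P x t := rfl

instance (P : Measure (Obs 𝒳)) [IsFiniteMeasure P] (t : Bool) (x : 𝒳) :
    IsProbabilityMeasure (outcomeLaw P x t) := by
  rw [← outcomeKernel_apply]; infer_instance

/-- The law of the covariates paired with an outcome drawn from arm `t`. -/
def armLaw (P : Measure (Obs 𝒳)) [IsFiniteMeasure P] (t : Bool) : Measure (𝒳 × ℝ) :=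
  P.map Prod.fst ⊗ₘ outcomeKernel P t

instance (P : Measure (Obs 𝒳)) [IsProbabilityMeasure P] :
    IsProbabilityMeasure (P.map Prod.fst) :=
  Measure.isProbabilityMeasure_map (by fun_prop)

instance (P : Measure (Obs 𝒳)) [IsProbabilityMeasure P] (t : Bool) :
    IsProbabilityMeasure (armLaw P t) := by
  unfold armLaw; infer_instance

variable (P : Measure (Obs 𝒳)) [IsProbabilityMeasure P]

/-- The true propensity of arm `t`. -/
def armProb (t : Bool) (x : 𝒳) : ℝ :=
  (condDistrib (fun z : Obs 𝒳 => z.2.2) (fun z : Obs 𝒳 => z.1) P x).real {t}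

lemma measureReal_bool (ρ : Measure Bool) [IsProbabilityMeasure ρ] (t : Bool) :
    ρ.real {t} = if t then ρ.real {true} else 1 - ρ.real {true} := by
  cases t
  · rw [show ({false} : Set Bool) = {true}ᶜ by ext b; cases b <;> simp,
      probReal_compl_eq_one_sub (by simp)]
    simp
  · simp

lemma armProb_eq (Λ : ℝ) (t : Bool) (x : 𝒳) : armProb P t x = (trueNuisance Λ P).eT t x := by
  rw [armProb, measureReal_bool]; rfl

lemma armProb_nonneg (t : Bool) (x : 𝒳) : 0 ≤ armProb P t x := measureReal_nonneg

lemma armProb_le_one (t : Bool) (x : 𝒳) : armProb P t x ≤ 1 := measureReal_le_one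

lemma measurable_armProb (t : Bool) : Measurable (armProb P t) :=
  (Kernel.measurable_coe _ (by simp)).ennreal_toReal

/-- Disintegrate twice: P is the law of X, followed by the treatment given X, followed by Y given
(X, A). Fixing A = t keeps a single term of the sum over treatments and leaves its propensity as
density. -/
lemma map_restrict_arm :
    ∀ t, (P.restrict ((fun z : Obs 𝒳 => z.2.2) ⁻¹' {t})).map (fun z : Obs 𝒳 => (z.1, z.2.1)) =
      (armLaw P t).withDensity fun v => ENNReal.ofReal (armProb P t v.1) := by
  intro t
  have h1 := compProd_map_condDistrib (mβ := inferInstance) (μ := P)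
    (X := fun z : Obs 𝒳 => (z.1, z.2.2))
    (Y := fun z : Obs 𝒳 => z.2.1) (by fun_prop)
  have h2 := compProd_map_condDistrib (mβ := inferInstance) (μ := P) (X := fun z : Obs 𝒳 => z.1)
    (Y := fun z : Obs 𝒳 => z.2.2) (by fun_prop)
  refine Measure.ext_of_lintegral _ fun g hg => ?_
  have hS : MeasurableSet ((fun z : Obs 𝒳 => z.2.2) ⁻¹' {t}) :=
    (by fun_prop : Measurable fun z : Obs 𝒳 => z.2.2) (by simp)
  rw [lintegral_map hg (by fun_prop), ← lintegral_indicator hS,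
    lintegral_withDensity_eq_lintegral_mul _ (by have := measurable_armProb P t; fun_prop) hg]
  set G : (𝒳 × Bool) × ℝ → ENNReal := fun w => if w.1.2 = t then g (w.1.1, w.2) else 0 with hG
  have hGm : Measurable G := by
    refine Measurable.ite ?_ (by fun_prop) (by fun_prop)
    exact (by fun_prop : Measurable fun w : (𝒳 × Bool) × ℝ => w.1.2) (measurableSet_singleton t)
  have e1 : ∫⁻ z : Obs 𝒳, ((fun z : Obs 𝒳 => z.2.2) ⁻¹' {t}).indicator
        (fun z => g (z.1, z.2.1)) z ∂P =
      ∫⁻ w, G w ∂(P.map fun z : Obs 𝒳 => ((z.1, z.2.2), z.2.1)) := by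
    rw [lintegral_map hGm (by fun_prop)]
    refine lintegral_congr fun z => ?_
    by_cases h : z.2.2 = t <;> simp [G, Set.indicator, h]
  rw [e1, ← h1, Measure.lintegral_compProd hGm, ← h2, Measure.lintegral_compProd (by fun_prop),
    armLaw, Measure.lintegral_compProd (by have := measurable_armProb P t; fun_prop)]
  refine lintegral_congr fun x => ?_
  simp only [Pi.mul_apply, G]
  rw [lintegral_const_mul _ (by fun_prop)]
  rw [lintegral_fintype]
  rw [Finset.sum_eq_single t (by intro b _ hb; simp [hb]) (by simp)]
  simp [armProb, mul_comm, outcomeKernel]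

lemma fst_armLaw (t : Bool) : (armLaw P t).map Prod.fst = P.map Prod.fst :=
  Measure.fst_compProd _ _

lemma integrable_covariate_iff (t : Bool) {g : 𝒳 → ℝ} (hg : Measurable g) :
    Integrable (fun z : Obs 𝒳 => g z.1) P ↔ Integrable (fun v : 𝒳 × ℝ => g v.1) (armLaw P t) := by
  have h1 := integrable_map_measure (μ := P) (f := Prod.fst) (g := g)
    hg.aestronglyMeasurable measurable_fst.aemeasurable
  have h2 := integrable_map_measure (μ := armLaw P t) (f := Prod.fst) (g := g)
    hg.aestronglyMeasurable measurable_fst.aemeasurable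
  rw [fst_armLaw] at h2
  exact h1.symm.trans h2

lemma integral_covariate (t : Bool) {g : 𝒳 → ℝ} (hg : Measurable g) :
    ∫ z : Obs 𝒳, g z.1 ∂P = ∫ v : 𝒳 × ℝ, g v.1 ∂(armLaw P t) := by
  rw [← integral_map (μ := P) (φ := Prod.fst) (f := g) measurable_fst.aemeasurable
    hg.aestronglyMeasurable, ← fst_armLaw P t, integral_map measurable_fst.aemeasurable
    hg.aestronglyMeasurable]

lemma integrable_arm_iff (t : Bool) {g : 𝒳 × ℝ → ℝ} (hg : Measurable g) :
    Integrable (fun z : Obs 𝒳 => arm t z.2.2 * g (z.1, z.2.1)) P ↔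
      Integrable (fun v => armProb P t v.1 * g v) (armLaw P t) :=
  integrable_arm_mul_iff (by fun_prop) (by fun_prop)
    ((measurable_armProb P t).comp measurable_fst) (fun _ => armProb_nonneg P t _)
    (map_restrict_arm P t) hg

lemma integral_arm (t : Bool) {g : 𝒳 × ℝ → ℝ} (hg : Measurable g) :
    ∫ z : Obs 𝒳, arm t z.2.2 * g (z.1, z.2.1) ∂P =
      ∫ v, armProb P t v.1 * g v ∂(armLaw P t) :=
  integral_arm_mul (by fun_prop) (by fun_prop)
    ((measurable_armProb P t).comp measurable_fst) (fun _ => armProb_nonneg P t _)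
    (map_restrict_arm P t) hg

variable {P} in
lemma ae_armLaw_of_ae {t : Bool} {p : 𝒳 → Prop} (h : ∀ᵐ x ∂(P.map Prod.fst), p x) :
    ∀ᵐ v ∂(armLaw P t), p v.1 := by
  rw [← fst_armLaw P t] at h
  exact ae_of_ae_map measurable_fst.aemeasurable h

/-- A property of `(x, a)` that holds almost surely holds for almost every `x` in every arm with
positive propensity. -/
lemma ae_covariate_of_ae_arm (he : ∀ᵐ x ∂(P.map Prod.fst), ∀ t, 0 < armProb P t x)
    {p : 𝒳 → Bool → Prop} (h : ∀ᵐ z ∂P, p z.1 z.2.2)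
    (hp : ∀ t, MeasurableSet {x | p x t}) :
    ∀ᵐ x ∂(P.map Prod.fst), ∀ t, p x t := by
  have h2 := compProd_map_condDistrib (mβ := inferInstance) (μ := P) (X := fun z : Obs 𝒳 => z.1)
    (Y := fun z : Obs 𝒳 => z.2.2) (by fun_prop)
  have hS : MeasurableSet {w : 𝒳 × Bool | p w.1 w.2} := by
    have : {w : 𝒳 × Bool | p w.1 w.2} = ⋃ t, {x | p x t} ×ˢ {t} := by
      ext ⟨x, a⟩; simp
    rw [this]
    exact MeasurableSet.iUnion fun t => (hp t).prod (by simp)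
  have h3 : ∀ᵐ w ∂(P.map fun z : Obs 𝒳 => (z.1, z.2.2)), p w.1 w.2 := by
    rw [ae_map_iff (by fun_prop) hS]
    exact h
  rw [← h2] at h3
  have h4 := Measure.ae_ae_of_ae_compProd h3
  filter_upwards [h4, he] with x hx hex t
  -- If the property failed at t, the singleton {t} would be null for the conditional law of A given
  -- x, against positive propensity.
  by_contra hc
  have : (condDistrib (fun z : Obs 𝒳 => z.2.2) (fun z : Obs 𝒳 => z.1) P x) {t} = 0 :=
    measure_mono_null (by intro b hb; simp at hb; subst hb; exact hc) hx
  have h5 := hex t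
  simp [armProb, measureReal_def, this] at h5

end Observed

/-! ### Quantiles of a law on the line -/

section Quantile

variable (ρ : Measure ℝ) {τ : ℝ}

/-- Right continuity of the distribution function makes the infimum attained; the limits at ±∞ make
the set nonempty and bounded below. This Galois connection yields all further facts about the
quantile, including its measurability in x. -/
lemma sInf_le_iff_le_cdf (h0 : 0 < τ) (h1 : τ < 1) (c : ℝ) :
    sInf {c : ℝ | τ ≤ cdf ρ c} ≤ c ↔ τ ≤ cdf ρ c := by
  set S := {c : ℝ | τ ≤ cdf ρ c} with hS
  have hne : S.Nonempty := by
    obtain ⟨b, hb⟩ := ((tendsto_cdf_atTop ρ).eventually (lt_mem_nhds h1)).exists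
    exact ⟨b, hb.le⟩
  have hbd : BddBelow S := by
    obtain ⟨b, hb⟩ := ((tendsto_cdf_atBot ρ).eventually (gt_mem_nhds h0)).exists
    refine ⟨b, fun s hs => le_of_not_gt fun hlt => ?_⟩
    exact absurd (hs.trans (monotone_cdf ρ hlt.le)) (not_le.2 hb)
  refine ⟨fun h => ?_, fun h => csInf_le hbd h⟩
  have key : τ ≤ cdf ρ (sInf S) := by
    have hr : Tendsto (cdf ρ) (𝓝[>] (sInf S)) (𝓝 (cdf ρ (sInf S))) :=
      ((cdf ρ).right_continuous (sInf S)).tendsto.mono_left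
        (nhdsWithin_mono _ Set.Ioi_subset_Ici_self)
    refine ge_of_tendsto hr ?_
    filter_upwards [self_mem_nhdsWithin] with b hb
    obtain ⟨s, hs, hsb⟩ := exists_lt_of_csInf_lt hne hb
    exact le_trans hs (monotone_cdf ρ hsb.le)
  exact key.trans (monotone_cdf ρ h)

variable [IsProbabilityMeasure ρ]

/-- The mass strictly below the quantile is a left limit of the distribution function, which stays
below τ to the left of the infimum. -/
lemma measureReal_Iio_sInf_le (h0 : 0 < τ) (h1 : τ < 1) :
    ρ.real (Set.Iio (sInf {c : ℝ | τ ≤ cdf ρ c})) ≤ τ := by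
  set q := sInf {c : ℝ | τ ≤ cdf ρ c} with hq
  have hm : Tendsto (cdf ρ) (𝓝[<] q) (𝓝 (Function.leftLim (cdf ρ) q)) :=
    (monotone_cdf ρ).tendsto_leftLim q
  have hIio : ρ.real (Set.Iio q) = Function.leftLim (cdf ρ) q := by
    have := (cdf ρ).measure_Iio (tendsto_cdf_atBot ρ) q
    rw [measure_cdf] at this
    rw [measureReal_def, this, ENNReal.toReal_ofReal, sub_zero]
    rw [sub_zero]
    refine ge_of_tendsto hm (Eventually.of_forall fun _ => cdf_nonneg _ _)
  rw [hIio]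
  refine le_of_tendsto hm ?_
  filter_upwards [self_mem_nhdsWithin] with b hb
  by_contra hc
  exact absurd ((sInf_le_iff_le_cdf ρ h0 h1 b).2 (not_le.1 hc).le) (not_le.2 hb)

lemma le_measureReal_Iic_sInf (h0 : 0 < τ) (h1 : τ < 1) :
    τ ≤ ρ.real (Set.Iic (sInf {c : ℝ | τ ≤ cdf ρ c})) := by
  rw [← cdf_eq_real]
  exact (sInf_le_iff_le_cdf ρ h0 h1 _).1 le_rfl

lemma measure_singleton_of_continuousAt_cdf {q : ℝ} (h : ContinuousAt (cdf ρ) q) :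
    ρ {q} = 0 := by
  have := (cdf ρ).measure_singleton q
  rw [measure_cdf] at this
  rw [this, (monotone_cdf ρ).continuousAt_iff_leftLim_eq_rightLim.1 h, (cdf ρ).rightLim_eq q]
  simp

/-- A quantile of level at most `1/2` is controlled by the first absolute moment. -/
lemma ofReal_mul_enorm_sInf_le (h0 : 0 < τ) (h1 : τ ≤ 1 / 2) :
    ENNReal.ofReal τ * ‖sInf {c : ℝ | τ ≤ cdf ρ c}‖ₑ ≤ ∫⁻ y, ‖y‖ₑ ∂ρ := by
  have h1' : τ < 1 := by linarith
  have ha := measureReal_Iio_sInf_le ρ h0 h1'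
  have hb := le_measureReal_Iic_sInf ρ h0 h1'
  set q := sInf {c : ℝ | τ ≤ cdf ρ c} with hq
  -- For q ≥ 0 the event contains {y ≥ q}, of mass at least 1 - τ ≥ τ; this is where τ ≤ 1/2 enters.
  -- For q < 0 it contains {y ≤ q}, of mass at least τ. Markov's inequality then concludes.
  have key : τ ≤ ρ.real {y | ‖q‖ₑ ≤ ‖y‖ₑ} := by
    rcases le_or_gt 0 q with hq0 | hq0
    · have : τ ≤ ρ.real (Set.Iio q)ᶜ := by
        rw [probReal_compl_eq_one_sub measurableSet_Iio]; linarith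
      refine this.trans (measureReal_mono fun y hy => ?_)
      simp only [Set.mem_compl_iff, Set.mem_Iio, not_lt] at hy
      simp only [Set.mem_ofPred_eq, enorm_le_iff_norm_le, Real.norm_eq_abs]
      exact abs_le_abs_of_nonneg hq0 hy
    · refine hb.trans (measureReal_mono fun y hy => ?_)
      simp only [Set.mem_Iic] at hy
      simp only [Set.mem_ofPred_eq, enorm_le_iff_norm_le, Real.norm_eq_abs]
      rw [abs_of_neg hq0, abs_of_nonpos (hy.trans hq0.le)]
      linarith
  calc ENNReal.ofReal τ * ‖q‖ₑ ≤ ρ {y | ‖q‖ₑ ≤ ‖y‖ₑ} * ‖q‖ₑ := by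
        gcongr
        rw [← ofReal_measureReal]
        exact ENNReal.ofReal_le_ofReal key
    _ ≤ ∫⁻ y, ‖y‖ₑ ∂ρ := by
        rw [mul_comm]
        exact mul_meas_ge_le_lintegral (by fun_prop) _

end Quantile

/-! ### Measurability and integrability of the true nuisance functions -/

section TrueNuisance

variable {𝒳 : Type*} [MeasurableSpace 𝒳] {Λ : ℝ} (P : Measure (Obs 𝒳)) [IsProbabilityMeasure P]

lemma level_pos (hΛ : 1 ≤ Λ) : 0 < 1 / (1 + Λ) := by positivity

lemma level_le_half (hΛ : 1 ≤ Λ) : 1 / (1 + Λ) ≤ 1 / 2 :=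
  one_div_le_one_div_of_le (by norm_num) (by linarith)

lemma level_lt_one (hΛ : 1 ≤ Λ) : 1 / (1 + Λ) < 1 := by linarith [level_le_half hΛ]

lemma measurable_lowerQuantile (hΛ : 1 ≤ Λ) (t : Bool) :
    Measurable fun x => lowerQuantile Λ P x t := by
  refine measurable_of_Iic fun c => ?_
  have : (fun x => lowerQuantile Λ P x t) ⁻¹' Set.Iic c =
      {x | 1 / (1 + Λ) ≤ (outcomeKernel P t x).real (Set.Iic c)} := by
    ext x
    simp only [Set.mem_preimage, Set.mem_Iic, Set.mem_ofPred_eq, lowerQuantile,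
      outcomeKernel_apply, ← cdf_eq_real]
    exact sInf_le_iff_le_cdf _ (level_pos hΛ) (level_lt_one hΛ) c
  rw [this]
  exact measurableSet_le measurable_const
    ((Kernel.measurable_coe _ measurableSet_Iic).ennreal_toReal)

lemma measurable_setIntegral_outcomeLaw (t : Bool) {s : Set (𝒳 × ℝ)} (hs : MeasurableSet s) :
    Measurable fun x => ∫ y in Prod.mk x ⁻¹' s, y ∂(outcomeLaw P x t) := by
  have h : StronglyMeasurable fun x => ∫ y, s.indicator Prod.snd (x, y) ∂(outcomeKernel P t x) :=
    StronglyMeasurable.integral_kernel_prod_right'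
      (measurable_snd.indicator hs).stronglyMeasurable
  convert h.measurable using 2 with x
  rw [← integral_indicator (measurable_prodMk_left hs)]
  rfl

lemma measurable_trueNuisance_rho1 (hΛ : 1 ≤ Λ) (t : Bool) :
    Measurable fun x => (trueNuisance Λ P).rho1 x t :=
  measurable_setIntegral_outcomeLaw P t (s := {v | v.2 < lowerQuantile Λ P v.1 t})
    (measurableSet_lt measurable_snd ((measurable_lowerQuantile P hΛ t).comp measurable_fst))

lemma measurable_trueNuisance_rho0 (hΛ : 1 ≤ Λ) (t : Bool) :
    Measurable fun x => (trueNuisance Λ P).rho0 x t :=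
  measurable_setIntegral_outcomeLaw P t (s := {v | lowerQuantile Λ P v.1 t < v.2})
    (measurableSet_lt ((measurable_lowerQuantile P hΛ t).comp measurable_fst) measurable_snd)

variable {P} {t : Bool}

/-- The conditional Markov bound of `ofReal_mul_enorm_sInf_le`, integrated over the covariates: the
level 1/(1+Λ) does not depend on x. -/
lemma integrable_lowerQuantile
    (hy : Integrable (fun v : 𝒳 × ℝ => v.2) (armLaw P t))
    (hΛ : 1 ≤ Λ) :
    Integrable (fun v : 𝒳 × ℝ => lowerQuantile Λ P v.1 t) (armLaw P t) := by
  have hm := measurable_lowerQuantile P hΛ t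
  refine ⟨(hm.comp measurable_fst).aestronglyMeasurable, ?_⟩
  have hτ := level_pos hΛ
  have h2 : ENNReal.ofReal (1 / (1 + Λ)) *
      ∫⁻ v : 𝒳 × ℝ, ‖lowerQuantile Λ P v.1 t‖ₑ ∂(armLaw P t) ≤
      ∫⁻ v : 𝒳 × ℝ, ‖v.2‖ₑ ∂(armLaw P t) := by
    rw [armLaw, Measure.lintegral_compProd (by fun_prop), Measure.lintegral_compProd (by fun_prop),
      ← lintegral_const_mul _ (by fun_prop)]
    refine lintegral_mono fun x => ?_
    simp only [lintegral_const, measure_univ, mul_one]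
    exact ofReal_mul_enorm_sInf_le (outcomeLaw P x t) hτ (level_le_half hΛ)
  refine lt_of_le_of_ne le_top fun htop => ?_
  rw [htop, ENNReal.mul_top (by simpa using hτ)] at h2
  exact (hy.2.trans_le h2).ne rfl

lemma integrable_setIntegral_outcomeLaw
    (hy : Integrable (fun v : 𝒳 × ℝ => v.2) (armLaw P t))
    {s : Set (𝒳 × ℝ)} (hs : MeasurableSet s) :
    Integrable (fun v : 𝒳 × ℝ => ∫ y in Prod.mk v.1 ⁻¹' s, y ∂(outcomeLaw P v.1 t))
      (armLaw P t) := by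
  have h1 : Integrable (fun x => ∫ y, s.indicator Prod.snd (x, y) ∂(outcomeKernel P t x))
      (P.map Prod.fst) := by
    have h2 : Integrable (s.indicator fun v : 𝒳 × ℝ => v.2) (armLaw P t) := hy.indicator hs
    rw [armLaw, Measure.compProd] at h2
    simpa using h2.integral_compProd
  rw [← fst_armLaw P t] at h1
  have h3 := h1.comp_measurable measurable_fst
  refine h3.congr (ae_of_all _ fun v => ?_)
  simp only [Function.comp_apply]
  rw [← integral_indicator (measurable_prodMk_left hs)]
  rfl

lemma integrable_trueNuisance_rho1
    (hy : Integrable (fun v : 𝒳 × ℝ => v.2) (armLaw P t))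
    (hΛ : 1 ≤ Λ) :
    Integrable (fun v : 𝒳 × ℝ => (trueNuisance Λ P).rho1 v.1 t) (armLaw P t) :=
  integrable_setIntegral_outcomeLaw hy (s := {v | v.2 < lowerQuantile Λ P v.1 t})
    (measurableSet_lt measurable_snd ((measurable_lowerQuantile P hΛ t).comp measurable_fst))

lemma integrable_trueNuisance_rho0
    (hy : Integrable (fun v : 𝒳 × ℝ => v.2) (armLaw P t))
    (hΛ : 1 ≤ Λ) :
    Integrable (fun v : 𝒳 × ℝ => (trueNuisance Λ P).rho0 v.1 t) (armLaw P t) :=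
  integrable_setIntegral_outcomeLaw hy (s := {v | lowerQuantile Λ P v.1 t < v.2})
    (measurableSet_lt ((measurable_lowerQuantile P hΛ t).comp measurable_fst) measurable_snd)

end TrueNuisance

/-- The quantity 1/p - 1 is the inverse odds. The interval [1/Λ, Λ] is invariant under inversion, so
both arms obey the same bounds, in the form needed for inverse-probability weights. -/
lemma odds_ratio_bounds {Λ p n : ℝ} (hΛ : 1 ≤ Λ) (hp : p ∈ Set.Icc (0 : ℝ) 1)
    (hn : n ∈ Set.Icc (0 : ℝ) 1) (h1 : 1 / Λ ≤ odds p / odds n) (h2 : odds p / odds n ≤ Λ)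
    (t : Bool) :
    0 < (if t then p else 1 - p) ∧ 0 < (if t then n else 1 - n) ∧
      Λ⁻¹ * (1 / (if t then n else 1 - n) - 1) ≤ 1 / (if t then p else 1 - p) - 1 ∧
      1 / (if t then p else 1 - p) - 1 ≤ Λ * (1 / (if t then n else 1 - n) - 1) := by
  have hΛ0 : 0 < Λ := by linarith
  have hpos : 0 < odds p / odds n := lt_of_lt_of_le (by positivity) h1
  -- At an endpoint the quotient of odds is 0, by the convention x / 0 = 0 where needed, so its
  -- positivity excludes all four endpoints.
  have hp0 : p ≠ 0 := by rintro rfl; simp [odds] at hpos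
  have hp1 : p ≠ 1 := by rintro rfl; simp [odds] at hpos
  have hn0 : n ≠ 0 := by rintro rfl; simp [odds] at hpos
  have hn1 : n ≠ 1 := by rintro rfl; simp [odds] at hpos
  have a1 : 0 < p := lt_of_le_of_ne hp.1 hp0.symm
  have a2 : 0 < 1 - p := sub_pos.2 (lt_of_le_of_ne hp.2 hp1)
  have b1 : 0 < n := lt_of_le_of_ne hn.1 hn0.symm
  have b2 : 0 < 1 - n := sub_pos.2 (lt_of_le_of_ne hn.2 hn1)
  have e : odds p / odds n = p * (1 - n) / ((1 - p) * n) := by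
    unfold odds; field_simp
  rw [e] at h1 h2
  rw [div_le_div_iff₀ hΛ0 (by positivity)] at h1
  rw [div_le_iff₀ (by positivity)] at h2
  have c1 : 1 / p - 1 = (1 - p) / p := by field_simp
  have c2 : 1 / n - 1 = (1 - n) / n := by field_simp
  have c3 : 1 / (1 - p) - 1 = p / (1 - p) := by field_simp; ring
  have c4 : 1 / (1 - n) - 1 = n / (1 - n) := by field_simp; ring
  cases t
  · simp only [Bool.false_eq_true, if_false]
    refine ⟨a2, b2, ?_, ?_⟩
    · rw [c3, c4, ← div_eq_inv_mul, div_div, div_le_div_iff₀ (by positivity) a2]; linarith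
    · rw [c3, c4, ← mul_div_assoc, div_le_div_iff₀ a2 b2]; linarith
  · simp only [if_true]
    refine ⟨a1, b1, ?_, ?_⟩
    · rw [c1, c2, ← div_eq_inv_mul, div_div, div_le_div_iff₀ (by positivity) a1]; linarith
    · rw [c1, c2, ← mul_div_assoc, div_le_div_iff₀ a1 b1]; linarith

/-! ### Full data and inverse-probability weighting under the sensitivity model -/

section FullData

variable {𝒳 : Type*} {k : ℕ}

/-- The pair of potential outcomes. -/
def Full.outcomes (o : Full 𝒳 k) : ℝ × ℝ := (Full.pot true o, Full.pot false o)

/-- The potential outcome of arm `t`, read off the pair `(Y(1), Y(0))`. -/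
def outcomeAt (t : Bool) (y : ℝ × ℝ) : ℝ := if t then y.1 else y.2

lemma outcomeAt_outcomes (t : Bool) (o : Full 𝒳 k) :
    outcomeAt t (Full.outcomes o) = Full.pot t o := by
  cases t <;> rfl

/-- Consistency: on A = t the observed outcome is Y(t), and off that event both sides vanish. -/
lemma arm_mul_pot_eq (t : Bool) (o : Full 𝒳 k) (g : 𝒳 × ℝ → ℝ) :
    arm t o.A * g (o.X, o.pot t) =
      arm t (Full.obs o).2.2 * g ((Full.obs o).1, (Full.obs o).2.1) := by
  by_cases hA : o.A = t
  · subst hA; rfl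
  · have : (Full.obs o).2.2 = o.A := rfl
    simp [arm, this, hA]

end FullData

section Full

variable {𝒳 : Type*} [MeasurableSpace 𝒳] {k : ℕ}

lemma Full.measurable_X : Measurable (Full.X : Full 𝒳 k → 𝒳) := by
  unfold Full.X; fun_prop

lemma Full.measurable_pot (t : Bool) : Measurable (Full.pot t : Full 𝒳 k → ℝ) := by
  unfold Full.pot; cases t <;> simp <;> fun_prop

lemma Full.measurable_A : Measurable (Full.A : Full 𝒳 k → Bool) := by
  unfold Full.A; fun_prop

lemma Full.measurable_outcomes : Measurable (Full.outcomes : Full 𝒳 k → ℝ × ℝ) :=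
  (Full.measurable_pot true).prodMk (Full.measurable_pot false)

lemma Full.measurable_obs : Measurable (Full.obs : Full 𝒳 k → Obs 𝒳) := by
  have h : Measurable fun o : Full 𝒳 k => Full.pot (Full.A o) o := by
    have : (fun o : Full 𝒳 k => Full.pot (Full.A o) o) =
        fun o => if Full.A o = true then Full.pot true o else Full.pot false o := by
      funext o; cases Full.A o <;> simp
    rw [this]
    exact Measurable.ite (Full.measurable_A (measurableSet_singleton true))
      (Full.measurable_pot true) (Full.measurable_pot false)
  exact Full.measurable_X.prodMk (h.prodMk Full.measurable_A)

lemma measurable_outcomeAt (t : Bool) : Measurable (outcomeAt t) := by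
  unfold outcomeAt; cases t <;> simp <;> fun_prop

lemma measurable_arm_mul (t : Bool) {g : 𝒳 × ℝ → ℝ} (hg : Measurable g) :
    Measurable fun z : Obs 𝒳 => arm t z.2.2 * g (z.1, z.2.1) := by
  have : Measurable (arm t) := measurable_from_top
  fun_prop

section ObservedLaw

variable {Q : Measure (Full 𝒳 k)} {P : Measure (Obs 𝒳)}

lemma ae_obs_of_ae_X (hP : Q.map Full.obs = P) {p : 𝒳 → Prop} (hp : MeasurableSet {x | p x}) :
    (∀ᵐ o ∂Q, p (Full.X o)) ↔ ∀ᵐ x ∂(P.map Prod.fst), p x := by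
  subst hP
  rw [Measure.map_map measurable_fst Full.measurable_obs,
    ae_map_iff (measurable_fst.comp Full.measurable_obs).aemeasurable hp]
  rfl

lemma integrable_obs_iff (hP : Q.map Full.obs = P) {g : Obs 𝒳 → ℝ} (hg : Measurable g) :
    Integrable (fun o => g (Full.obs o)) Q ↔ Integrable g P := by
  subst hP
  exact (integrable_map_measure hg.aestronglyMeasurable Full.measurable_obs.aemeasurable).symm

lemma integral_obs (hP : Q.map Full.obs = P) {g : Obs 𝒳 → ℝ} (hg : Measurable g) :
    ∫ o, g (Full.obs o) ∂Q = ∫ z, g z ∂P := by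
  subst hP
  exact (integral_map Full.measurable_obs.aemeasurable hg.aestronglyMeasurable).symm

variable [IsProbabilityMeasure P]

lemma integrable_arm_armProb_iff (hpos : ∀ᵐ x ∂(P.map Prod.fst), ∀ t, 0 < armProb P t x)
    (t : Bool) {g : 𝒳 × ℝ → ℝ} (hg : Measurable g) :
    Integrable (fun z : Obs 𝒳 => arm t z.2.2 * (g (z.1, z.2.1) / armProb P t z.1)) P ↔
      Integrable g (armLaw P t) := by
  have hs := measurable_armProb P t
  rw [integrable_arm_iff P t (g := fun v => g v / armProb P t v.1) (by fun_prop)]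
  refine integrable_congr ?_
  filter_upwards [ae_armLaw_of_ae hpos] with v hv
  exact mul_div_cancel₀ _ (hv t).ne'

end ObservedLaw

/-- `Q(A = t | X, U)`. -/
def scoreProb (Q : Measure (Full 𝒳 k)) [IsFiniteMeasure Q] (t : Bool) (xu : 𝒳 × (Fin k → ℝ)) : ℝ :=
  (condDistrib Full.A Full.XU Q xu).real {t}

variable (Q : Measure (Full 𝒳 k)) [IsProbabilityMeasure Q]

lemma measurable_scoreProb (t : Bool) : Measurable (scoreProb Q t) :=
  (Kernel.measurable_coe _ (by simp)).ennreal_toReal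

lemma scoreProb_eq (t : Bool) (xu : 𝒳 × (Fin k → ℝ)) :
    scoreProb Q t xu = if t then truePropensity Q xu else 1 - truePropensity Q xu :=
  measureReal_bool _ _

lemma fullNominalPropensity_eq (P : Measure (Obs 𝒳)) [IsProbabilityMeasure P]
    (hP : Q.map Full.obs = P) (x : 𝒳) :
    fullNominalPropensity Q x = nominalPropensity P x := by
  have e : P.map (fun z : Obs 𝒳 => (z.1, z.2.2)) =
      Q.map fun o : Full 𝒳 k => (Full.X o, Full.A o) := by
    rw [← hP, Measure.map_map (by fun_prop) Full.measurable_obs]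
    rfl
  simp only [fullNominalPropensity, nominalPropensity, condDistrib, e]

variable {Q} [StandardBorelSpace 𝒳] {Λ : ℝ}

lemma IsMSM.ae_bounds (h : IsMSM Λ Q) (hΛ : 1 ≤ Λ) (P : Measure (Obs 𝒳)) [IsProbabilityMeasure P]
    (hP : Q.map Full.obs = P) :
    ∀ᵐ o ∂Q, ∀ t, 0 < scoreProb Q t o.XU ∧ 0 < armProb P t o.X ∧
      Λ⁻¹ * (1 / armProb P t o.X - 1) ≤ 1 / scoreProb Q t o.XU - 1 ∧
      1 / scoreProb Q t o.XU - 1 ≤ Λ * (1 / armProb P t o.X - 1) := by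
  filter_upwards [h.oddsRatio] with o ho t
  rw [fullNominalPropensity_eq Q P hP] at ho
  have := odds_ratio_bounds hΛ (p := truePropensity Q o.XU) (n := nominalPropensity P o.X)
    ⟨measureReal_nonneg, measureReal_le_one⟩ ⟨measureReal_nonneg, measureReal_le_one⟩ ho.1 ho.2 t
  rw [scoreProb_eq, show armProb P t o.X = _ from measureReal_bool _ t]
  exact this

/-- By conditional independence the law of A given (X, U, Y(1), Y(0)) ignores the outcomes, so the
density of the restriction to A = t is a function of (X, U) only. -/
lemma IsMSM.map_restrict_arm (h : IsMSM Λ Q) (t : Bool) :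
    (Q.restrict (Full.A ⁻¹' {t})).map (fun o => (Full.XU o, Full.outcomes o)) =
      (Q.map fun o => (Full.XU o, Full.outcomes o)).withDensity
        fun v => ENNReal.ofReal (scoreProb Q t v.1) := by
  have hYm := Full.measurable_outcomes (𝒳 := 𝒳) (k := k)
  have hAm := Full.measurable_A (𝒳 := 𝒳) (k := k)
  have hXm := Full.measurable_XU (𝒳 := 𝒳) (k := k)
  have h1 := (condIndepFun_iff_condDistrib_prod_ae_eq_prodMkRight (μ := Q) hAm hYm hXm).1
    h.condIndep
  rw [condDistrib_ae_eq_iff_measure_eq_compProd _ hAm.aemeasurable] at h1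
  have h2 := map_restrict_arm_of_map_eq_compProd (t := t) (hXm.prodMk hYm) hAm h1
  exact h2

/-- Inverse-probability weighting: the mean of a function of `(X, U, Y(1), Y(0))` is its weighted
mean over the arm `A = t`. -/
lemma IsMSM.integrable_weighted_iff (h : IsMSM Λ Q) (hpos : ∀ᵐ o ∂Q, ∀ t, 0 < scoreProb Q t o.XU)
    (t : Bool) {g : (𝒳 × (Fin k → ℝ)) × (ℝ × ℝ) → ℝ} (hg : Measurable g) :
    Integrable (fun o => arm t o.A * (g (o.XU, o.outcomes) / scoreProb Q t o.XU)) Q ↔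
      Integrable (fun o => g (o.XU, o.outcomes)) Q := by
  have hYm := Full.measurable_outcomes (𝒳 := 𝒳) (k := k)
  have hXm := Full.measurable_XU (𝒳 := 𝒳) (k := k)
  have hVm := hXm.prodMk hYm
  have hs := measurable_scoreProb Q t
  have hgs : Measurable fun v : (𝒳 × (Fin k → ℝ)) × (ℝ × ℝ) =>
      scoreProb Q t v.1 * (g v / scoreProb Q t v.1) := by fun_prop
  rw [integrable_arm_mul_iff (f := fun o : Full 𝒳 k => (o.XU, o.outcomes)) hVm Full.measurable_A
    (p := fun v => scoreProb Q t v.1) (hs.comp measurable_fst) (fun _ => measureReal_nonneg)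
    (h.map_restrict_arm t) (g := fun v => g v / scoreProb Q t v.1) (by fun_prop),
    integrable_map_measure hgs.aestronglyMeasurable hVm.aemeasurable]
  refine integrable_congr ?_
  filter_upwards [hpos] with o ho
  simp only [Function.comp_apply]
  exact mul_div_cancel₀ _ (ho t).ne'

lemma IsMSM.integral_weighted (h : IsMSM Λ Q) (hpos : ∀ᵐ o ∂Q, ∀ t, 0 < scoreProb Q t o.XU)
    (t : Bool) {g : (𝒳 × (Fin k → ℝ)) × (ℝ × ℝ) → ℝ} (hg : Measurable g) :
    ∫ o, arm t o.A * (g (o.XU, o.outcomes) / scoreProb Q t o.XU) ∂Q =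
      ∫ o, g (o.XU, o.outcomes) ∂Q := by
  have hYm := Full.measurable_outcomes (𝒳 := 𝒳) (k := k)
  have hXm := Full.measurable_XU (𝒳 := 𝒳) (k := k)
  have hVm := hXm.prodMk hYm
  have hs := measurable_scoreProb Q t
  have hgs : Measurable fun v : (𝒳 × (Fin k → ℝ)) × (ℝ × ℝ) =>
      scoreProb Q t v.1 * (g v / scoreProb Q t v.1) := by fun_prop
  rw [integral_arm_mul (f := fun o : Full 𝒳 k => (o.XU, o.outcomes)) hVm Full.measurable_A
    (p := fun v => scoreProb Q t v.1) (hs.comp measurable_fst) (fun _ => measureReal_nonneg)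
    (h.map_restrict_arm t) (g := fun v => g v / scoreProb Q t v.1) (by fun_prop),
    integral_map hVm.aemeasurable hgs.aestronglyMeasurable]
  refine integral_congr_ae ?_
  filter_upwards [hpos] with o ho
  exact mul_div_cancel₀ _ (ho t).ne'

section ObservedLaw

variable {P : Measure (Obs 𝒳)} [IsProbabilityMeasure P]

lemma IsMSM.ae_armProb_pos (h : IsMSM Λ Q) (hΛ : 1 ≤ Λ) (hP : Q.map Full.obs = P) :
    ∀ᵐ x ∂(P.map Prod.fst), ∀ t, 0 < armProb P t x := by
  rw [← ae_obs_of_ae_X hP]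
  · filter_upwards [h.ae_bounds hΛ P hP] with o ho t using (ho t).2.1
  · simp only [Bool.forall_bool]
    exact (measurableSet_lt measurable_const (measurable_armProb P _)).inter
      (measurableSet_lt measurable_const (measurable_armProb P _))

/-- Under the sensitivity model, the potential outcome of arm `t` has a mean exactly when the
outcome has a mean under the law of the covariates paired with the arm's outcome kernel. -/
lemma IsMSM.integrable_pot_iff (h : IsMSM Λ Q) (hΛ : 1 ≤ Λ) (hP : Q.map Full.obs = P) (t : Bool) :
    Integrable (Full.pot t) Q ↔ Integrable (fun v : 𝒳 × ℝ => v.2) (armLaw P t) := by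
  have hb := h.ae_bounds hΛ P hP
  have hpos : ∀ᵐ o ∂Q, ∀ t, 0 < scoreProb Q t o.XU := by
    filter_upwards [hb] with o ho t using (ho t).1
  have hsm := (measurable_scoreProb Q t).comp Full.measurable_XU
  have ham := (measurable_armProb P t)
  have hpm := Full.measurable_pot (𝒳 := 𝒳) (k := k) t
  have hAm : Measurable fun o : Full 𝒳 k => arm t o.A :=
    (measurable_from_top : Measurable (arm t)).comp Full.measurable_A
  have hXm := Full.measurable_X (𝒳 := 𝒳) (k := k)
  have hΛ0 : 0 < Λ := by linarith
  have e1 := h.integrable_weighted_iff hpos t (g := fun v => outcomeAt t v.2)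
    ((measurable_outcomeAt t).comp measurable_snd)
  simp only [outcomeAt_outcomes] at e1
  rw [← integrable_arm_armProb_iff (h.ae_armProb_pos hΛ hP) t measurable_snd,
    ← integrable_obs_iff hP (measurable_arm_mul t (g := fun v => v.2 / armProb P t v.1)
      (by fun_prop))]
  simp only [← arm_mul_pot_eq t _ fun v : 𝒳 × ℝ => v.2 / armProb P t v.1]
  rw [show Full.pot t = fun o : Full 𝒳 k => Full.pot t o from rfl, ← e1]
  have habs : ∀ a y p : ℝ, 0 ≤ a → 0 < p → ‖a * (y / p)‖ = a * |y| * (1 / p) := by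
    intro a y p ha hp
    rw [norm_mul, norm_div, Real.norm_of_nonneg ha, Real.norm_of_nonneg hp.le, Real.norm_eq_abs]
    ring
  constructor
  · intro hi
    refine (hi.norm.const_mul Λ).mono' (by fun_prop) ?_
    filter_upwards [hb] with o ho
    obtain ⟨h1, h2, h3, -⟩ := ho t
    have ha := arm_nonneg t o.A
    rw [habs _ _ _ ha h1, habs _ _ _ ha h2]
    -- The model bounds the weights minus one; removing the ones leaves 1 - Λ ≤ 0.
    have h4 : 1 / armProb P t o.X ≤ Λ * (1 / scoreProb Q t o.XU) := by
      have := mul_le_mul_of_nonneg_left h3 hΛ0.le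
      rw [← mul_assoc, mul_inv_cancel₀ hΛ0.ne'] at this
      linarith
    calc arm t o.A * |o.pot t| * (1 / armProb P t o.X)
        ≤ arm t o.A * |o.pot t| * (Λ * (1 / scoreProb Q t o.XU)) := by gcongr
      _ = _ := by ring
  · intro hi
    refine (hi.norm.const_mul Λ).mono' (by fun_prop) ?_
    filter_upwards [hb] with o ho
    obtain ⟨h1, h2, -, h3⟩ := ho t
    have ha := arm_nonneg t o.A
    rw [habs _ _ _ ha h1, habs _ _ _ ha h2]
    have h4 : 1 / scoreProb Q t o.XU ≤ Λ * (1 / armProb P t o.X) := by linarith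
    calc arm t o.A * |o.pot t| * (1 / scoreProb Q t o.XU)
        ≤ arm t o.A * |o.pot t| * (Λ * (1 / armProb P t o.X)) := by gcongr
      _ = _ := by ring

end ObservedLaw

end Full

/-! ### The pointwise worst-case reweighting -/

section Tilt

/-- The deviation `y - q` tilted by `Λ` below and by `Λ⁻¹` above the threshold `q`. -/
def tilt (Λ y q : ℝ) : ℝ := min (Λ * (y - q)) (Λ⁻¹ * (y - q))

variable {Λ : ℝ}

lemma inv_le_self_of_one_le (hΛ : 1 ≤ Λ) : Λ⁻¹ ≤ Λ := (inv_le_one_of_one_le₀ hΛ).trans hΛ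

lemma tilt_of_le (hΛ : 1 ≤ Λ) {y q : ℝ} (h : q ≤ y) : tilt Λ y q = Λ⁻¹ * (y - q) :=
  min_eq_right (mul_le_mul_of_nonneg_right (inv_le_self_of_one_le hΛ) (sub_nonneg.2 h))

lemma tilt_of_ge (hΛ : 1 ≤ Λ) {y q : ℝ} (h : y ≤ q) : tilt Λ y q = Λ * (y - q) :=
  min_eq_left (mul_le_mul_of_nonpos_right (inv_le_self_of_one_le hΛ) (sub_nonpos.2 h))

/-- The outcome and the quantile correction of the score combine to the tilted deviation. -/
lemma weighted_add_correction (hΛ : 1 ≤ Λ) (y q : ℝ) :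
    y * Λ ^ (-sgn (y - q)) + q * (Λ - Λ⁻¹) * (1 / (1 + Λ) - below y q) = tilt Λ y q + q := by
  have hΛ0 : Λ ≠ 0 := by positivity
  have hΛ1 : 1 + Λ ≠ 0 := by positivity
  rcases le_or_gt q y with h | h
  · rw [tilt_of_le hΛ h, sgn, if_pos (sub_nonneg.2 h), below, if_neg (not_lt.2 h), zpow_neg_one]
    field_simp
    ring
  · rw [tilt_of_ge hΛ h.le, sgn, if_neg (by linarith), below, if_pos h, neg_neg, zpow_one]
    field_simp
    ring

/-- A linear function of w is minimal at an end of its interval: the upper end when y < q, the lower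
end when y > q. This one inequality is the whole lower bound on welfare. -/
lemma mul_tilt_le {y q r w : ℝ} (h1 : Λ⁻¹ * r ≤ w) (h2 : w ≤ Λ * r) (hΛ : 1 ≤ Λ) :
    r * tilt Λ y q ≤ w * (y - q) := by
  rcases le_total q y with h | h
  · rw [tilt_of_le hΛ h]
    have := mul_le_mul_of_nonneg_right h1 (sub_nonneg.2 h)
    linarith
  · rw [tilt_of_ge hΛ h]
    have := mul_le_mul_of_nonpos_right h2 (sub_nonpos.2 h)
    linarith

lemma abs_tilt_sub_le (hΛ : 1 ≤ Λ) (y q q' : ℝ) : |tilt Λ y q - tilt Λ y q'| ≤ Λ * |q - q'| := by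
  have hΛ0 : 0 < Λ := by linarith
  refine (abs_min_sub_min_le_max _ _ _ _).trans (max_le ?_ ?_)
  · rw [← mul_sub, abs_mul, abs_of_pos hΛ0, show y - q - (y - q') = -(q - q') by ring, abs_neg]
  · rw [← mul_sub, abs_mul, abs_of_pos (inv_pos.2 hΛ0),
      show y - q - (y - q') = -(q - q') by ring, abs_neg]
    exact mul_le_mul_of_nonneg_right (inv_le_self_of_one_le hΛ) (abs_nonneg _)

lemma abs_tilt_le (hΛ : 1 ≤ Λ) (y q : ℝ) : |tilt Λ y q| ≤ Λ * |y| + Λ * |q| := by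
  have h0 : tilt Λ y y = 0 := by simp [tilt]
  have h := abs_tilt_sub_le hΛ y q y
  rw [h0, sub_zero] at h
  have : |q - y| ≤ |q| + |y| := abs_sub _ _
  nlinarith

@[fun_prop]
lemma _root_.Measurable.tilt {α : Type*} [MeasurableSpace α] {f g : α → ℝ} (hf : Measurable f)
    (hg : Measurable g) : Measurable fun a => tilt Λ (f a) (g a) := by
  unfold RobustPolicy.tilt; fun_prop

end Tilt

/-! ### The score in terms of the tilt -/

section Score

variable {𝒳 : Type*} {Λ : ℝ}

/-- The combination `Λ ρ₁ + Λ⁻¹ ρ₀` that enters the score. -/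
def Nuisance.rho (Λ : ℝ) (η : Nuisance 𝒳) (t : Bool) (x : 𝒳) : ℝ :=
  Λ * η.rho1 x t + Λ⁻¹ * η.rho0 x t

/-- The part of the score that is observed in the arm `t` only. -/
def armScore (Λ : ℝ) (η : Nuisance 𝒳) (t : Bool) (v : 𝒳 × ℝ) : ℝ :=
  v.2 + (1 / η.eT t v.1 - 1) * (tilt Λ v.2 (η.q v.1 t) + η.q v.1 t) - η.rho Λ t v.1 / η.eT t v.1

/-- Separates what is seen only in arm t from the term ρ, which is present for every observation;
the propensity must not vanish, so that the factor e_t in the last bracket cancels its denominator.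
-/
lemma phi_eq (hΛ : 1 ≤ Λ) (t : Bool) (z : Obs 𝒳) (η : Nuisance 𝒳) (h : η.eT t z.1 ≠ 0) :
    phi Λ t z η = arm t z.2.2 * armScore Λ η t (z.1, z.2.1) + η.rho Λ t z.1 := by
  unfold phi armScore Nuisance.rho
  rw [← weighted_add_correction hΛ]
  field_simp
  ring

/-- The score of arm `t` averaged over the treatment, as a function of covariates and outcome. -/
def meanScore (Λ : ℝ) (e : 𝒳 → ℝ) (η : Nuisance 𝒳) (t : Bool) (v : 𝒳 × ℝ) : ℝ :=
  e v.1 * v.2 + (e v.1 / η.eT t v.1 - e v.1) * (tilt Λ v.2 (η.q v.1 t) + η.q v.1 t)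
    - η.rho Λ t v.1 * (e v.1 / η.eT t v.1 - 1)

lemma policyProb_mem {π : 𝒳 → ℝ} (hπ : ∀ x, π x ∈ Set.Icc (0 : ℝ) 1) (t : Bool) (x : 𝒳) :
    policyProb π t x ∈ Set.Icc (0 : ℝ) 1 := by
  have := hπ x
  unfold policyProb
  split_ifs
  · exact this
  · exact ⟨by linarith [this.2], by linarith [this.1]⟩

lemma Nuisance.path_eT (η η' : Nuisance 𝒳) (r : ℝ) (t : Bool) (x : 𝒳) :
    (η.path η' r).eT t x = η.eT t x + r * (η'.eT t x - η.eT t x) := by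
  cases t
  · simp [Nuisance.eT, Nuisance.path]; ring
  · simp [Nuisance.eT, Nuisance.path]

lemma Nuisance.path_rho (η η' : Nuisance 𝒳) (r : ℝ) (t : Bool) (x : 𝒳) :
    (η.path η' r).rho Λ t x = η.rho Λ t x + r * (η'.rho Λ t x - η.rho Λ t x) := by
  simp [Nuisance.rho, Nuisance.path]; ring

lemma Nuisance.path_q (η η' : Nuisance 𝒳) (r : ℝ) (t : Bool) (x : 𝒳) :
    (η.path η' r).q x t = η.q x t + r * (η'.q x t - η.q x t) := rfl

end Score

/-! ### Integrability of the score and averaging over the treatment -/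

section Integrability

variable {𝒳 : Type*} [MeasurableSpace 𝒳] {Λ : ℝ} {P : Measure (Obs 𝒳)} [IsProbabilityMeasure P]

lemma measurable_policyProb {π : 𝒳 → ℝ} (hπ : Measurable π) (t : Bool) :
    Measurable (policyProb π t) := by
  unfold policyProb
  cases t <;> simp <;> fun_prop

/-- Measurable nuisance functions with integrable quantile and truncated means in arm `t`. -/
structure Nuisance.Regular (Λ : ℝ) (P : Measure (Obs 𝒳)) [IsProbabilityMeasure P] (t : Bool)
    (η : Nuisance 𝒳) : Prop where
  measurable_eT : Measurable (η.eT t)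
  measurable_q : Measurable fun x => η.q x t
  measurable_rho : Measurable (η.rho Λ t)
  integrable_q : Integrable (fun v : 𝒳 × ℝ => η.q v.1 t) (armLaw P t)
  integrable_rho : Integrable (fun v : 𝒳 × ℝ => η.rho Λ t v.1) (armLaw P t)

lemma Nuisance.measurable_eT_of {η : Nuisance 𝒳} (h : Measurable η.e) (t : Bool) :
    Measurable (η.eT t) := by
  unfold Nuisance.eT
  cases t <;> simp <;> fun_prop

lemma Nuisance.Admissible.regular {η : Nuisance 𝒳} (h : η.Admissible P) (t : Bool) :
    η.Regular Λ P t where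
  measurable_eT := Nuisance.measurable_eT_of h.measurable_e t
  measurable_q := h.measurable_q t
  measurable_rho := ((h.measurable_rho1 t).const_mul Λ).add ((h.measurable_rho0 t).const_mul Λ⁻¹)
  integrable_q := (integrable_covariate_iff P t (h.measurable_q t)).1 (h.integrable_q t)
  integrable_rho :=
    (((integrable_covariate_iff P t (h.measurable_rho1 t)).1 (h.integrable_rho1 t)).const_mul
      Λ).add (((integrable_covariate_iff P t (h.measurable_rho0 t)).1
        (h.integrable_rho0 t)).const_mul Λ⁻¹)

lemma regular_trueNuisance (hΛ : 1 ≤ Λ) {t : Bool}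
    (hy : Integrable (fun v : 𝒳 × ℝ => v.2) (armLaw P t)) :
    (trueNuisance Λ P).Regular Λ P t where
  measurable_eT := by
    rw [show (trueNuisance Λ P).eT t = armProb P t from funext fun x => (armProb_eq P Λ t x).symm]
    exact measurable_armProb P t
  measurable_q := measurable_lowerQuantile P hΛ t
  measurable_rho := ((measurable_trueNuisance_rho1 P hΛ t).const_mul Λ).add
    ((measurable_trueNuisance_rho0 P hΛ t).const_mul Λ⁻¹)
  integrable_q := integrable_lowerQuantile hy hΛ
  integrable_rho := ((integrable_trueNuisance_rho1 hy hΛ).const_mul Λ).add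
    ((integrable_trueNuisance_rho0 hy hΛ).const_mul Λ⁻¹)

lemma Nuisance.Regular.path {t : Bool} {η η' : Nuisance 𝒳} (h : η.Regular Λ P t)
    (h' : η'.Regular Λ P t) (r : ℝ) : (η.path η' r).Regular Λ P t where
  measurable_eT := by
    simp_rw [funext (Nuisance.path_eT η η' r t)]
    exact h.measurable_eT.add ((h'.measurable_eT.sub h.measurable_eT).const_mul r)
  measurable_q := h.measurable_q.add ((h'.measurable_q.sub h.measurable_q).const_mul r)
  measurable_rho := by
    simp_rw [funext (Nuisance.path_rho η η' r t)]
    exact h.measurable_rho.add ((h'.measurable_rho.sub h.measurable_rho).const_mul r)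
  integrable_q := h.integrable_q.add ((h'.integrable_q.sub h.integrable_q).const_mul r)
  integrable_rho := by
    simp_rw [Nuisance.path_rho]
    exact h.integrable_rho.add ((h'.integrable_rho.sub h.integrable_rho).const_mul r)

lemma integrable_tilt_add {t : Bool} (hΛ : 1 ≤ Λ)
    (hy : Integrable (fun v : 𝒳 × ℝ => v.2) (armLaw P t)) {q : 𝒳 → ℝ} (hqm : Measurable q)
    (hq : Integrable (fun v : 𝒳 × ℝ => q v.1) (armLaw P t)) :
    Integrable (fun v : 𝒳 × ℝ => tilt Λ v.2 (q v.1) + q v.1) (armLaw P t) := by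
  refine Integrable.add (((hy.norm.const_mul Λ).add (hq.norm.const_mul Λ)).mono'
    (by fun_prop : Measurable fun v : 𝒳 × ℝ => tilt Λ v.2 (q v.1)).aestronglyMeasurable
    (ae_of_all _ fun v => ?_)) hq
  exact abs_tilt_le hΛ _ _

/-- Bounded multiples of integrable functions of covariates and outcome are integrable. -/
lemma integrable_bdd_mul {t : Bool} {c : 𝒳 → ℝ} (hc : Measurable c) {C : ℝ}
    (hC : ∀ᵐ x ∂(P.map Prod.fst), |c x| ≤ C) {f : 𝒳 × ℝ → ℝ} (hf : Integrable f (armLaw P t)) :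
    Integrable (fun v : 𝒳 × ℝ => c v.1 * f v) (armLaw P t) :=
  hf.bdd_mul (hc.comp measurable_fst).aestronglyMeasurable (ae_armLaw_of_ae hC)

variable {t : Bool} {η : Nuisance 𝒳} {π : 𝒳 → ℝ}

/-- Comparability e_t ≤ C ẽ_t stands in for an overlap condition: it forces ẽ_t > 0 and bounds the
only unbounded-looking weight e_t/ẽ_t. -/
lemma ae_ratio_bounds {C : ℝ} (hpos : ∀ᵐ x ∂(P.map Prod.fst), ∀ t, 0 < armProb P t x)
    (hC : ∀ᵐ x ∂(P.map Prod.fst), armProb P t x ≤ C * η.eT t x) (hC0 : 0 < C) :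
    ∀ᵐ x ∂(P.map Prod.fst), 0 < η.eT t x ∧ |armProb P t x / η.eT t x| ≤ C := by
  filter_upwards [hpos, hC] with x h1 h2
  have h3 : 0 < η.eT t x := by
    by_contra h
    have := mul_nonpos_of_nonneg_of_nonpos hC0.le (not_lt.1 h)
    linarith [h1 t]
  refine ⟨h3, ?_⟩
  rw [abs_of_nonneg (div_nonneg (h1 t).le h3.le), div_le_iff₀ h3]
  exact h2

/-- The weight 1/ẽ_t may be unbounded, but it occurs only on A = t, where passing to `armLaw`
multiplies it by e_t. Every coefficient is then bounded, and the remaining factors are integrable.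
-/
lemma Nuisance.Regular.integrable_phi (h : η.Regular Λ P t) (hΛ : 1 ≤ Λ)
    (hy : Integrable (fun v : 𝒳 × ℝ => v.2) (armLaw P t))
    (hpos : ∀ᵐ x ∂(P.map Prod.fst), ∀ t, 0 < armProb P t x) {C : ℝ} (hC0 : 0 < C)
    (hC : ∀ᵐ x ∂(P.map Prod.fst), armProb P t x ≤ C * η.eT t x)
    (hπ : Measurable π) (hπ01 : ∀ x, π x ∈ Set.Icc (0 : ℝ) 1) :
    Integrable (fun z => phi Λ t z η * policyProb π t z.1) P ∧
    Integrable (fun v => policyProb π t v.1 * meanScore Λ (armProb P t) η t v) (armLaw P t) ∧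
    ∫ z, phi Λ t z η * policyProb π t z.1 ∂P =
      ∫ v, policyProb π t v.1 * meanScore Λ (armProb P t) η t v ∂(armLaw P t) := by
  have hb := ae_ratio_bounds hpos hC hC0
  have m1 := h.measurable_eT
  have m2 := h.measurable_q
  have m3 := h.measurable_rho
  have m4 := measurable_armProb P t
  have m5 := measurable_policyProb hπ t
  have hp1 : ∀ᵐ x ∂(P.map Prod.fst), |policyProb π t x| ≤ 1 := ae_of_all _ fun x =>
    abs_le.2 ⟨by linarith [(policyProb_mem hπ01 t x).1], (policyProb_mem hπ01 t x).2⟩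
  have he1 : ∀ᵐ x ∂(P.map Prod.fst), |armProb P t x| ≤ 1 := ae_of_all _ fun x =>
    abs_le.2 ⟨by linarith [armProb_nonneg P t x], armProb_le_one P t x⟩
  have hw : ∀ᵐ x ∂(P.map Prod.fst), |armProb P t x / η.eT t x - armProb P t x| ≤ C + 1 := by
    filter_upwards [hb, he1] with x h1 h2
    exact (abs_sub _ _).trans (add_le_add h1.2 h2)
  have i1 : Integrable (fun v : 𝒳 × ℝ => armProb P t v.1 * v.2 +
      (armProb P t v.1 / η.eT t v.1 - armProb P t v.1) * (tilt Λ v.2 (η.q v.1 t) + η.q v.1 t)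
      - armProb P t v.1 / η.eT t v.1 * η.rho Λ t v.1) (armLaw P t) :=
    ((integrable_bdd_mul m4 he1 hy).add (integrable_bdd_mul (by fun_prop) hw
      (integrable_tilt_add hΛ hy m2 h.integrable_q))).sub
      (integrable_bdd_mul (m4.div m1) (hb.mono fun x hx => hx.2) h.integrable_rho)
  have i1' := integrable_bdd_mul m5 hp1 i1
  have i2 : Integrable (fun v : 𝒳 × ℝ => policyProb π t v.1 * η.rho Λ t v.1) (armLaw P t) :=
    integrable_bdd_mul m5 hp1 h.integrable_rho
  have i2' : Integrable (fun z : Obs 𝒳 => policyProb π t z.1 * η.rho Λ t z.1) P :=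
    (integrable_covariate_iff P t (m5.mul m3)).2 i2
  have hgm : Measurable fun v => policyProb π t v.1 * armScore Λ η t v := by
    unfold armScore; fun_prop
  have e1 : (fun v => armProb P t v.1 * (policyProb π t v.1 * armScore Λ η t v)) = fun v =>
      policyProb π t v.1 * (armProb P t v.1 * v.2 +
      (armProb P t v.1 / η.eT t v.1 - armProb P t v.1) * (tilt Λ v.2 (η.q v.1 t) + η.q v.1 t)
      - armProb P t v.1 / η.eT t v.1 * η.rho Λ t v.1) := by
    funext v; unfold armScore; ring
  have i3 := integrable_arm_iff P t hgm
  rw [e1] at i3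
  replace i3 := i3.2 i1'
  have e3 := integral_arm P t hgm
  rw [e1] at e3
  have e4 : (fun z => phi Λ t z η * policyProb π t z.1) =ᵐ[P] fun z =>
      arm t z.2.2 * (policyProb π t z.1 * armScore Λ η t (z.1, z.2.1)) +
        policyProb π t z.1 * η.rho Λ t z.1 := by
    filter_upwards [ae_of_ae_map measurable_fst.aemeasurable hb] with z hz
    rw [phi_eq hΛ t z η hz.1.ne']; ring
  have e5 : (fun v => policyProb π t v.1 * meanScore Λ (armProb P t) η t v) = fun v =>
      policyProb π t v.1 * (armProb P t v.1 * v.2 +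
      (armProb P t v.1 / η.eT t v.1 - armProb P t v.1) * (tilt Λ v.2 (η.q v.1 t) + η.q v.1 t)
      - armProb P t v.1 / η.eT t v.1 * η.rho Λ t v.1) + policyProb π t v.1 * η.rho Λ t v.1 := by
    funext v; unfold meanScore; ring
  refine ⟨(i3.add i2').congr e4.symm, ?_, ?_⟩
  · rw [e5]; exact i1'.add i2
  · rw [integral_congr_ae e4, e5, integral_add i3 i2', integral_add i1' i2, e3]
    congr 1
    exact integral_covariate P t (m5.mul m3)

end Integrability

/-! ### The lower bound on the welfare of a policy -/

lemma policyOutcome_eq {𝒳 : Type*} {k : ℕ} (π : 𝒳 → ℝ) :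
    Full.policyOutcome π = fun o : Full 𝒳 k =>
      policyProb π true o.X * o.pot true + policyProb π false o.X * o.pot false := rfl

section Welfare

variable {𝒳 : Type*} [MeasurableSpace 𝒳] {Λ : ℝ} {P : Measure (Obs 𝒳)} [IsProbabilityMeasure P]

/-- The contribution of arm `t` to the worst-case welfare. -/
def armValue (Λ : ℝ) (P : Measure (Obs 𝒳)) [IsProbabilityMeasure P] (π : 𝒳 → ℝ) (t : Bool) : ℝ :=
  ∫ v, policyProb π t v.1 * (armProb P t v.1 * v.2 + (1 - armProb P t v.1) *
    (tilt Λ v.2 (lowerQuantile Λ P v.1 t) + lowerQuantile Λ P v.1 t)) ∂(armLaw P t)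

/-- At the truth e_t/ẽ_t = 1, so the ρ term drops out; hence no continuity at the quantile is
required here. -/
lemma integral_phi_trueNuisance (hΛ : 1 ≤ Λ) {t : Bool}
    (hy : Integrable (fun v : 𝒳 × ℝ => v.2) (armLaw P t))
    (hpos : ∀ᵐ x ∂(P.map Prod.fst), ∀ t, 0 < armProb P t x)
    {π : 𝒳 → ℝ} (hπ : Measurable π) (hπ01 : ∀ x, π x ∈ Set.Icc (0 : ℝ) 1) :
    Integrable (fun z => phi Λ t z (trueNuisance Λ P) * policyProb π t z.1) P ∧
    ∫ z, phi Λ t z (trueNuisance Λ P) * policyProb π t z.1 ∂P = armValue Λ P π t := by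
  obtain ⟨h1, -, h2⟩ := (regular_trueNuisance hΛ hy).integrable_phi hΛ hy hpos one_pos
    (ae_of_all _ fun x => by rw [one_mul, armProb_eq P Λ]) hπ hπ01
  refine ⟨h1, h2.trans (integral_congr_ae ?_)⟩
  filter_upwards [ae_armLaw_of_ae hpos] with v hv
  unfold meanScore
  rw [← armProb_eq P Λ, div_self (hv t).ne', sub_self, mul_zero, sub_zero]
  rfl

variable [StandardBorelSpace 𝒳] {k : ℕ} {Q : Measure (Full 𝒳 k)} [IsProbabilityMeasure Q]

/-- The excess of the inverse-probability weighted deviation of `Y(t)` from its quantile over its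
smallest value compatible with the sensitivity model. -/
def excess (Λ : ℝ) (P : Measure (Obs 𝒳)) [IsProbabilityMeasure P] (Q : Measure (Full 𝒳 k))
    [IsProbabilityMeasure Q] (t : Bool) (o : Full 𝒳 k) : ℝ :=
  (1 / scoreProb Q t o.XU - 1) * (o.pot t - lowerQuantile Λ P o.X t) -
    (1 / armProb P t o.X - 1) * tilt Λ (o.pot t) (lowerQuantile Λ P o.X t)

/-- Weight the deviation Y(t) - q by 1/s_t over the arm, then compare with the extremal weight. The
comparison term is a function of the observed data and is computed under P. Centring at q uses that
the weights average to one given X. -/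
lemma IsMSM.integral_policyProb_mul_pot (h : IsMSM Λ Q) (hΛ : 1 ≤ Λ) (hP : Q.map Full.obs = P)
    {t : Bool} (hpot : Integrable (Full.pot t) Q)
    {π : 𝒳 → ℝ} (hπ : Measurable π) (hπ01 : ∀ x, π x ∈ Set.Icc (0 : ℝ) 1) :
    Integrable (fun o => policyProb π t o.X * o.pot t) Q ∧
    ∫ o, policyProb π t o.X * o.pot t ∂Q =
      armValue Λ P π t + ∫ o, arm t o.A * policyProb π t o.X * excess Λ P Q t o ∂Q := by
  have hpos := h.ae_armProb_pos hΛ hP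
  have hb := h.ae_bounds hΛ P hP
  have hspos : ∀ᵐ o ∂Q, ∀ t, 0 < scoreProb Q t o.XU := by
    filter_upwards [hb] with o ho t using (ho t).1
  have hy := (h.integrable_pot_iff hΛ hP t).1 hpot
  set q : 𝒳 → ℝ := fun x => lowerQuantile Λ P x t with hq
  have mq : Measurable q := measurable_lowerQuantile P hΛ t
  have iq : Integrable (fun v : 𝒳 × ℝ => q v.1) (armLaw P t) := integrable_lowerQuantile hy hΛ
  have mp := measurable_policyProb hπ t
  have me := measurable_armProb P t
  have mX := Full.measurable_X (𝒳 := 𝒳) (k := k)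
  have mpot := Full.measurable_pot (𝒳 := 𝒳) (k := k) t
  have mat := measurable_outcomeAt t
  have hp1 : ∀ x, |policyProb π t x| ≤ 1 := fun x =>
    abs_le.2 ⟨by linarith [(policyProb_mem hπ01 t x).1], (policyProb_mem hπ01 t x).2⟩
  have he1 : ∀ x, |armProb P t x| ≤ 1 := fun x =>
    abs_le.2 ⟨by linarith [armProb_nonneg P t x], armProb_le_one P t x⟩
  have he2 : ∀ x, |1 - armProb P t x| ≤ 1 := fun x =>
    abs_le.2 ⟨by linarith [armProb_le_one P t x], by linarith [armProb_nonneg P t x]⟩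
  have i1 : Integrable (fun o => policyProb π t o.X * o.pot t) Q :=
    hpot.bdd_mul (mp.comp mX).aestronglyMeasurable (ae_of_all _ fun o => hp1 _)
  have i2ν : Integrable (fun v : 𝒳 × ℝ => policyProb π t v.1 * q v.1) (armLaw P t) :=
    integrable_bdd_mul mp (ae_of_all _ hp1) iq
  have i2P : Integrable (fun z : Obs 𝒳 => policyProb π t z.1 * q z.1) P :=
    (integrable_covariate_iff P t (mp.mul mq)).2 i2ν
  have mzX : Measurable fun z : Obs 𝒳 => policyProb π t z.1 * q z.1 := by fun_prop
  have i2 : Integrable (fun o : Full 𝒳 k => policyProb π t o.X * q o.X) Q :=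
    (integrable_obs_iff hP mzX).2 i2P
  have e2 : ∫ o : Full 𝒳 k, policyProb π t o.X * q o.X ∂Q =
      ∫ v : 𝒳 × ℝ, policyProb π t v.1 * q v.1 ∂(armLaw P t) :=
    (integral_obs hP mzX).trans (integral_covariate P t (mp.mul mq))
  -- the weighted deviation
  set g : (𝒳 × (Fin k → ℝ)) × (ℝ × ℝ) → ℝ := fun v =>
    policyProb π t v.1.1 * outcomeAt t v.2 - policyProb π t v.1.1 * q v.1.1 with hg
  have mg : Measurable g := by fun_prop
  have eg : ∀ o : Full 𝒳 k, g (o.XU, o.outcomes) =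
      policyProb π t o.X * o.pot t - policyProb π t o.X * q o.X := by
    intro o; simp only [hg, outcomeAt_outcomes]; rfl
  have ig : Integrable (fun o : Full 𝒳 k => g (o.XU, o.outcomes)) Q := by
    simp_rw [eg]; exact i1.sub i2
  have i3 := (h.integrable_weighted_iff hspos t mg).2 ig
  have e3 := h.integral_weighted hspos t mg
  -- the observed part
  set f : 𝒳 × ℝ → ℝ := fun v => policyProb π t v.1 *
    (v.2 - q v.1 + (1 / armProb P t v.1 - 1) * tilt Λ v.2 (q v.1)) with hf
  have mf : Measurable f := by fun_prop
  have ef : (fun v => armProb P t v.1 * f v) =ᵐ[armLaw P t] fun v =>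
      policyProb π t v.1 * (armProb P t v.1 * v.2 + (1 - armProb P t v.1) *
        (tilt Λ v.2 (q v.1) + q v.1)) - policyProb π t v.1 * q v.1 := by
    filter_upwards [ae_armLaw_of_ae hpos] with v hv
    have := (hv t).ne'
    simp only [hf]
    field_simp
    ring
  have iB : Integrable (fun v : 𝒳 × ℝ =>
      policyProb π t v.1 * (armProb P t v.1 * v.2 + (1 - armProb P t v.1) *
        (tilt Λ v.2 (q v.1) + q v.1))) (armLaw P t) :=
    integrable_bdd_mul mp (ae_of_all _ hp1) ((integrable_bdd_mul me (ae_of_all _ he1) hy).add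
      (integrable_bdd_mul (measurable_const.sub me) (ae_of_all _ he2)
        (integrable_tilt_add hΛ hy mq iq)))
  have i4 : Integrable (fun z : Obs 𝒳 => arm t z.2.2 * f (z.1, z.2.1)) P := by
    rw [integrable_arm_iff P t mf, integrable_congr ef]
    exact iB.sub i2ν
  have e4 : ∫ z : Obs 𝒳, arm t z.2.2 * f (z.1, z.2.1) ∂P =
      armValue Λ P π t - ∫ v : 𝒳 × ℝ, policyProb π t v.1 * q v.1 ∂(armLaw P t) := by
    rw [integral_arm P t mf, integral_congr_ae ef, integral_sub iB i2ν]
    rfl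
  have i5 := (integrable_obs_iff hP (measurable_arm_mul t mf)).2 i4
  have e5 := integral_obs hP (measurable_arm_mul t mf)
  simp only [← arm_mul_pot_eq t _ f] at i5 e5
  -- Both terms on the right contain the deviation with weight one; it cancels and leaves the
  -- difference of the weights minus one.
  have e6 : (fun o => arm t o.A * policyProb π t o.X * excess Λ P Q t o) = fun o : Full 𝒳 k =>
      arm t o.A * (g (o.XU, o.outcomes) / scoreProb Q t o.XU) -
        arm t o.A * f (o.X, o.pot t) := by
    funext o
    rw [eg]
    simp only [excess, hf, hq]
    ring
  refine ⟨i1, ?_⟩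
  rw [e6, integral_sub i3 i5, e3, e5, e4]
  simp_rw [eg]
  rw [integral_sub i1 i2, e2]
  ring

lemma IsMSM.ae_excess_nonneg (h : IsMSM Λ Q) (hΛ : 1 ≤ Λ) (hP : Q.map Full.obs = P) (t : Bool) :
    ∀ᵐ o ∂Q, 0 ≤ excess Λ P Q t o := by
  filter_upwards [h.ae_bounds hΛ P hP] with o ho
  exact sub_nonneg.2 (mul_tilt_le (ho t).2.2.1 (ho t).2.2.2 hΛ)

/-- The welfare of a policy under a law in the sensitivity model is the sum of the arm values and
of the mean excesses. -/
lemma IsMSM.integral_policyOutcome (h : IsMSM Λ Q) (hΛ : 1 ≤ Λ) (hP : Q.map Full.obs = P)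
    (hpot : ∀ t, Integrable (Full.pot t) Q)
    {π : 𝒳 → ℝ} (hπ : Measurable π) (hπ01 : ∀ x, π x ∈ Set.Icc (0 : ℝ) 1) :
    Integrable (Full.policyOutcome π) Q ∧
    ∫ o, Full.policyOutcome π o ∂Q = ∑ t, armValue Λ P π t +
      ∑ t, ∫ o, arm t o.A * policyProb π t o.X * excess Λ P Q t o ∂Q := by
  have h1 := h.integral_policyProb_mul_pot hΛ hP (hpot true) hπ hπ01
  have h0 := h.integral_policyProb_mul_pot hΛ hP (hpot false) hπ hπ01
  rw [policyOutcome_eq]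
  refine ⟨h1.1.add h0.1, ?_⟩
  rw [integral_add h1.1 h0.1, h1.2, h0.2, Fintype.sum_bool, Fintype.sum_bool]
  ring

lemma IsMSM.sum_armValue_le (h : IsMSM Λ Q) (hΛ : 1 ≤ Λ) (hP : Q.map Full.obs = P)
    (hpot : ∀ t, Integrable (Full.pot t) Q)
    {π : 𝒳 → ℝ} (hπ : Measurable π) (hπ01 : ∀ x, π x ∈ Set.Icc (0 : ℝ) 1) :
    ∑ t, armValue Λ P π t ≤ ∫ o, Full.policyOutcome π o ∂Q := by
  rw [(h.integral_policyOutcome hΛ hP hpot hπ hπ01).2]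
  refine le_add_of_nonneg_right (Finset.sum_nonneg fun t _ => integral_nonneg_of_ae ?_)
  filter_upwards [h.ae_excess_nonneg hΛ hP t] with o ho
  exact mul_nonneg (mul_nonneg (arm_nonneg _ _) (policyProb_mem hπ01 t _).1) ho

end Welfare

/-! ### Kernels with two values -/

section BoolKernel

variable {α : Type*} [MeasurableSpace α]

/-- The kernel to `Bool` with weights `w`. -/
def boolKernel (w : Bool → α → ℝ) (hw : ∀ b, Measurable (w b)) : Kernel α Bool where
  toFun x := ∑ b, ENNReal.ofReal (w b x) • Measure.dirac b
  measurable' := by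
    refine Measure.measurable_of_measurable_coe _ fun s hs => ?_
    simp only [Measure.finsetSum_apply, Measure.smul_apply, smul_eq_mul]
    have := fun b => hw b
    fun_prop

variable {w : Bool → α → ℝ} (hw : ∀ b, Measurable (w b))

lemma boolKernel_apply (x : α) :
    boolKernel w hw x = ∑ b, ENNReal.ofReal (w b x) • Measure.dirac b := rfl

lemma boolKernel_singleton (x : α) (t : Bool) :
    boolKernel w hw x {t} = ENNReal.ofReal (w t x) := by
  rw [boolKernel_apply, Fintype.sum_bool]
  cases t <;> simp

lemma lintegral_boolKernel (x : α) (f : Bool → ENNReal) :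
    ∫⁻ b, f b ∂(boolKernel w hw x) = ∑ b, ENNReal.ofReal (w b x) * f b := by
  rw [lintegral_fintype]
  exact Finset.sum_congr rfl fun b _ => by rw [boolKernel_singleton, mul_comm]

lemma isMarkovKernel_boolKernel (h0 : ∀ b x, 0 ≤ w b x) (h1 : ∀ x, w true x + w false x = 1) :
    IsMarkovKernel (boolKernel w hw) := by
  refine ⟨fun x => ⟨?_⟩⟩
  rw [← lintegral_one, lintegral_boolKernel, Fintype.sum_bool, mul_one, mul_one,
    ← ENNReal.ofReal_add (h0 _ _) (h0 _ _), h1, ENNReal.ofReal_one]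

end BoolKernel

/-! ### Splitting a law at its quantile, with the atom shared -/

section Tail

variable {Λ : ℝ} (ρ : Measure ℝ)

/-- The `1 / (1 + Λ)`-quantile of a law on the line. -/
def quantile (Λ : ℝ) (ρ : Measure ℝ) : ℝ := sInf {c : ℝ | 1 / (1 + Λ) ≤ cdf ρ c}

/-- The share of the atom at the quantile that belongs to the lower tail of mass
`1 / (1 + Λ)`. -/
def atomShare (Λ : ℝ) (ρ : Measure ℝ) : ℝ :=
  (1 / (1 + Λ) - ρ.real (Set.Iio (quantile Λ ρ))) / ρ.real {quantile Λ ρ}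

/-- The density of the normalized lower tail of mass `1 / (1 + Λ)` if `s`, and of the normalized
upper tail of mass `Λ / (1 + Λ)` otherwise. -/
def tailDensity (Λ : ℝ) (ρ : Measure ℝ) (s : Bool) (y : ℝ) : ℝ :=
  if s then (1 + Λ) * ((Set.Iio (quantile Λ ρ)).indicator 1 y +
      atomShare Λ ρ * ({quantile Λ ρ} : Set ℝ).indicator 1 y)
    else (1 + Λ) / Λ * ((Set.Ioi (quantile Λ ρ)).indicator 1 y +
      (1 - atomShare Λ ρ) * ({quantile Λ ρ} : Set ℝ).indicator 1 y)

lemma le_quantile_of_tailDensity {s : Bool} {y : ℝ} (h : tailDensity Λ ρ s y ≠ 0) :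
    (s = true → y ≤ quantile Λ ρ) ∧ (s = false → quantile Λ ρ ≤ y) := by
  constructor
  · rintro rfl
    by_contra hc
    push Not at hc
    exact h (by simp [tailDensity, hc.le, hc.ne'])
  · rintro rfl
    by_contra hc
    push Not at hc
    exact h (by simp [tailDensity, hc.le, hc.ne])

/-- The tails receive complementary shares of the atom, so the identity holds at every point and
needs no property of the share. -/
lemma tailDensity_mix (hΛ : 1 ≤ Λ) (y : ℝ) :
    1 / (1 + Λ) * tailDensity Λ ρ true y + Λ / (1 + Λ) * tailDensity Λ ρ false y = 1 := by
  have h0 : Λ ≠ 0 := by positivity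
  have h1 : 1 + Λ ≠ 0 := by positivity
  rcases lt_trichotomy y (quantile Λ ρ) with h | h | h
  · simp [tailDensity, h, h.le, h.ne]; field_simp
  · simp [tailDensity, h]; field_simp; ring
  · simp [tailDensity, h, h.le, h.ne']; field_simp

variable [IsProbabilityMeasure ρ]

/-- The inequalities P(Y < q) ≤ 1/(1+Λ) ≤ P(Y ≤ q) say exactly that a fraction of the atom completes
the lower tail. -/
lemma atomShare_mem (hΛ : 1 ≤ Λ) : atomShare Λ ρ ∈ Set.Icc (0 : ℝ) 1 ∧
    ρ.real (Set.Iio (quantile Λ ρ)) + atomShare Λ ρ * ρ.real {quantile Λ ρ} = 1 / (1 + Λ) := by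
  have h1 := measureReal_Iio_sInf_le ρ (level_pos hΛ) (level_lt_one hΛ)
  have h2 := le_measureReal_Iic_sInf ρ (level_pos hΛ) (level_lt_one hΛ)
  change ρ.real (Set.Iio (quantile Λ ρ)) ≤ _ at h1
  change _ ≤ ρ.real (Set.Iic (quantile Λ ρ)) at h2
  rw [← Set.Iio_union_right, measureReal_union (by simp) (measurableSet_singleton _)] at h2
  refine ⟨⟨div_nonneg (sub_nonneg.2 h1) measureReal_nonneg,
    div_le_one_of_le₀ (by linarith) measureReal_nonneg⟩, ?_⟩
  unfold atomShare
  -- Without an atom the share is 0 by division by zero, and the two quantile inequalities already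
  -- force the mass below q to be the level.
  rcases eq_or_ne (ρ.real {quantile Λ ρ}) 0 with h | h
  · rw [h] at h2 ⊢; linarith
  · rw [div_mul_cancel₀ _ h]; ring

lemma tailDensity_nonneg (hΛ : 1 ≤ Λ) (s : Bool) (y : ℝ) : 0 ≤ tailDensity Λ ρ s y := by
  have h := (atomShare_mem ρ hΛ).1
  have h1 := h.1
  have h2 : 0 ≤ 1 - atomShare Λ ρ := sub_nonneg.2 h.2
  have hi : ∀ S : Set ℝ, 0 ≤ S.indicator (1 : ℝ → ℝ) y := fun S =>
    Set.indicator_nonneg (fun _ _ => zero_le_one) _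
  unfold tailDensity
  split_ifs
  · exact mul_nonneg (by positivity) (add_nonneg (hi _) (mul_nonneg h1 (hi _)))
  · exact mul_nonneg (by positivity) (add_nonneg (hi _) (mul_nonneg h2 (hi _)))

lemma lintegral_tailDensity (hΛ : 1 ≤ Λ) (s : Bool) :
    ∫⁻ y, ENNReal.ofReal (tailDensity Λ ρ s y) ∂ρ = 1 := by
  have hΛ0 : Λ ≠ 0 := by positivity
  have hΛ1 : 1 + Λ ≠ 0 := by positivity
  have hm := (atomShare_mem ρ hΛ).2
  have hi : ∀ S : Set ℝ, MeasurableSet S → Integrable (S.indicator (1 : ℝ → ℝ)) ρ := fun S hS =>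
    (integrable_const (1 : ℝ)).indicator hS
  have hs := measurableSet_singleton (quantile Λ ρ)
  have key : Integrable (tailDensity Λ ρ s) ρ ∧ ∫ y, tailDensity Λ ρ s y ∂ρ = 1 := by
    unfold tailDensity
    cases s
    · simp only [Bool.false_eq_true, if_false]
      refine ⟨((hi _ measurableSet_Ioi).add ((hi _ hs).const_mul _)).const_mul _, ?_⟩
      rw [integral_const_mul, integral_add (hi _ measurableSet_Ioi) ((hi _ hs).const_mul _),
        integral_const_mul, integral_indicator_one measurableSet_Ioi, integral_indicator_one hs]
      have hc : ρ.real (Set.Ioi (quantile Λ ρ)) =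
          1 - (ρ.real (Set.Iio (quantile Λ ρ)) + ρ.real {quantile Λ ρ}) := by
        rw [← measureReal_union (by simp) hs, Set.Iio_union_right, ← Set.compl_Iic,
          probReal_compl_eq_one_sub measurableSet_Iic]
      rw [hc, show ∀ a b c : ℝ, 1 - (a + b) + (1 - c) * b = 1 - (a + c * b) by intros; ring, hm]
      field_simp
      ring
    · simp only [if_true]
      refine ⟨((hi _ measurableSet_Iio).add ((hi _ hs).const_mul _)).const_mul _, ?_⟩
      rw [integral_const_mul, integral_add (hi _ measurableSet_Iio) ((hi _ hs).const_mul _),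
        integral_const_mul, integral_indicator_one measurableSet_Iio, integral_indicator_one hs,
        hm]
      field_simp
  rw [← ofReal_integral_eq_lintegral_ofReal key.1 (ae_of_all _ (tailDensity_nonneg ρ hΛ s)),
    key.2, ENNReal.ofReal_one]

end Tail

/-! ### The tails as kernels in the covariates -/

section TailKernel

variable {𝒳 : Type*} [MeasurableSpace 𝒳] {Λ : ℝ} (P : Measure (Obs 𝒳)) [IsProbabilityMeasure P]

lemma quantile_outcomeLaw (x : 𝒳) (t : Bool) :
    quantile Λ (outcomeLaw P x t) = lowerQuantile Λ P x t := rfl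

lemma measurable_tailDensity (hΛ : 1 ≤ Λ) (t : Bool) :
    Measurable fun w : (𝒳 × Bool) × ℝ => tailDensity Λ (outcomeLaw P w.1.1 t) w.1.2 w.2 := by
  have mq := measurable_lowerQuantile P hΛ t
  have mq' : Measurable fun w : 𝒳 × ℝ => lowerQuantile Λ P w.1 t := mq.comp measurable_fst
  have hrel : ∀ {S : Set (𝒳 × ℝ)}, MeasurableSet S →
      Measurable fun x => (outcomeLaw P x t).real (Prod.mk x ⁻¹' S) := fun hS =>
    (Kernel.measurable_kernel_prodMk_left (κ := outcomeKernel P t) hS).ennreal_toReal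
  have s1 : MeasurableSet {w : 𝒳 × ℝ | w.2 < lowerQuantile Λ P w.1 t} :=
    measurableSet_lt measurable_snd mq'
  have s2 : MeasurableSet {w : 𝒳 × ℝ | w.2 = lowerQuantile Λ P w.1 t} :=
    measurableSet_eq_fun measurable_snd mq'
  have s3 : MeasurableSet {w : 𝒳 × ℝ | lowerQuantile Λ P w.1 t < w.2} :=
    measurableSet_lt mq' measurable_snd
  have ma : Measurable fun x => atomShare Λ (outcomeLaw P x t) :=
    (measurable_const.sub (hrel s1)).div (hrel s2)
  have hind : ∀ {S : Set (𝒳 × ℝ)}, MeasurableSet S →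
      Measurable fun w : (𝒳 × Bool) × ℝ => S.indicator (1 : 𝒳 × ℝ → ℝ) (w.1.1, w.2) := fun hS =>
    (measurable_one.indicator hS).comp (by fun_prop)
  refine Measurable.ite ((by fun_prop : Measurable fun w : (𝒳 × Bool) × ℝ => w.1.2)
    (measurableSet_singleton true)) ?_ ?_
  · exact ((hind s1).add (((ma.comp measurable_fst).comp measurable_fst).mul
      (hind s2))).const_mul _
  · exact ((hind s3).add ((measurable_const.sub ((ma.comp measurable_fst).comp
      measurable_fst)).mul (hind s2))).const_mul _

/-- The kernel giving the normalized tail of the outcome law of arm `t`: the lower tail at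
`(x, true)` and the upper tail at `(x, false)`. -/
def tailKernel (Λ : ℝ) (P : Measure (Obs 𝒳)) [IsProbabilityMeasure P] (t : Bool) :
    Kernel (𝒳 × Bool) ℝ :=
  Kernel.withDensity ((outcomeKernel P t).comap Prod.fst measurable_fst)
    fun w y => ENNReal.ofReal (tailDensity Λ (outcomeLaw P w.1 t) w.2 y)

lemma tailKernel_apply (hΛ : 1 ≤ Λ) (t : Bool) (w : 𝒳 × Bool) :
    tailKernel Λ P t w = (outcomeLaw P w.1 t).withDensity fun y =>
      ENNReal.ofReal (tailDensity Λ (outcomeLaw P w.1 t) w.2 y) := by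
  rw [tailKernel, Kernel.withDensity_apply _ (measurable_tailDensity P hΛ t).ennreal_ofReal]
  rfl

lemma measurable_tailDensity_section (hΛ : 1 ≤ Λ) (t : Bool) (w : 𝒳 × Bool) :
    Measurable (tailDensity Λ (outcomeLaw P w.1 t) w.2) :=
  (measurable_tailDensity P hΛ t).comp measurable_prodMk_left

lemma isMarkovKernel_tailKernel (hΛ : 1 ≤ Λ) (t : Bool) : IsMarkovKernel (tailKernel Λ P t) := by
  refine ⟨fun w => ⟨?_⟩⟩
  rw [tailKernel_apply P hΛ, withDensity_apply _ MeasurableSet.univ, Measure.restrict_univ,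
    lintegral_tailDensity _ hΛ]

lemma ae_tailKernel (hΛ : 1 ≤ Λ) (t : Bool) (w : 𝒳 × Bool) :
    ∀ᵐ y ∂(tailKernel Λ P t w), (w.2 = true → y ≤ lowerQuantile Λ P w.1 t) ∧
      (w.2 = false → lowerQuantile Λ P w.1 t ≤ y) := by
  rw [tailKernel_apply P hΛ,
    ae_withDensity_iff (measurable_tailDensity_section P hΛ t w).ennreal_ofReal]
  refine ae_of_all _ fun y hy => le_quantile_of_tailDensity _ fun h0 => hy ?_
  rw [h0, ENNReal.ofReal_zero]

/-- The two normalized tails mix to the outcome law. -/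
lemma lintegral_tailKernel_mix (hΛ : 1 ≤ Λ) (t : Bool) (x : 𝒳) {f : ℝ → ENNReal}
    (hf : Measurable f) :
    ENNReal.ofReal (1 / (1 + Λ)) * ∫⁻ y, f y ∂(tailKernel Λ P t (x, true)) +
      ENNReal.ofReal (Λ / (1 + Λ)) * ∫⁻ y, f y ∂(tailKernel Λ P t (x, false)) =
      ∫⁻ y, f y ∂(outcomeLaw P x t) := by
  have hm := fun s => (measurable_tailDensity_section P hΛ t (x, s)).ennreal_ofReal
  have h0 := fun s y => tailDensity_nonneg (outcomeLaw P x t) hΛ s y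
  rw [tailKernel_apply P hΛ, tailKernel_apply P hΛ,
    lintegral_withDensity_eq_lintegral_mul _ (hm true) hf,
    lintegral_withDensity_eq_lintegral_mul _ (hm false) hf,
    ← lintegral_const_mul _ ((hm true).mul hf), ← lintegral_const_mul _ ((hm false).mul hf),
    ← lintegral_add_left (((hm true).mul hf).const_mul _)]
  refine lintegral_congr fun y => ?_
  simp only [Pi.mul_apply]
  rw [← mul_assoc, ← mul_assoc, ← add_mul, ← ENNReal.ofReal_mul (by positivity),
    ← ENNReal.ofReal_mul (by positivity),
    ← ENNReal.ofReal_add (mul_nonneg (by positivity) (h0 _ _))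
      (mul_nonneg (by positivity) (h0 _ _)), tailDensity_mix _ hΛ, ENNReal.ofReal_one, one_mul]

end TailKernel

/-! ### A binary confounder inside ℝ^k -/

section Encoding

variable {𝒳 : Type*} {k : ℕ}

/-- Encodes a binary confounder as a constant vector of zeros or ones. -/
def encode (k : ℕ) (w : 𝒳 × Bool) : 𝒳 × (Fin k → ℝ) := (w.1, fun _ => if w.2 then 1 else 0)

open Classical in
/-- Decodes a binary confounder. -/
def decode (v : 𝒳 × (Fin k → ℝ)) : 𝒳 × Bool := (v.1, decide (v.2 = fun _ => 1))

/-- For k = 0 the vectors of zeros and of ones coincide; this is the source of the condition k ≥ 1.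
-/
lemma decode_encode (hk : 1 ≤ k) (w : 𝒳 × Bool) : decode (encode k w) = w := by
  obtain ⟨x, b⟩ := w
  cases b
  · simp only [decode, encode, Prod.mk.injEq, true_and]
    refine decide_eq_false fun h => ?_
    have := congrFun h ⟨0, hk⟩
    simp at this
  · simp [decode, encode]

variable [MeasurableSpace 𝒳]

lemma measurable_encode : Measurable (encode k : 𝒳 × Bool → _) := by
  have : Measurable fun b : Bool => (fun _ => if b then 1 else 0 : Fin k → ℝ) :=
    measurable_from_top
  exact measurable_fst.prodMk (this.comp measurable_snd)

lemma measurable_decode : Measurable (decode : 𝒳 × (Fin k → ℝ) → _) := by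
  classical
  have : Measurable fun u : Fin k → ℝ => decide (u = fun _ => 1) := by
    refine measurable_to_bool ?_
    have : (fun u : Fin k → ℝ => decide (u = fun _ => 1)) ⁻¹' {true} = {fun _ => 1} := by
      ext; simp
    rw [this]
    exact measurableSet_singleton _
  refine measurable_fst.prodMk ?_
  convert this.comp measurable_snd using 2
  exact decide_eq_decide.2 Iff.rfl

end Encoding

/-! ### Construction of the worst-case law -/

section WorstCase

variable {𝒳 : Type*} [MeasurableSpace 𝒳] (Λ : ℝ) (P : Measure (Obs 𝒳)) [IsProbabilityMeasure P]

lemma armProb_add_not (t : Bool) (x : 𝒳) : armProb P t x + armProb P (!t) x = 1 := by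
  have h := fun t => measureReal_bool
    (condDistrib (fun z : Obs 𝒳 => z.2.2) (fun z : Obs 𝒳 => z.1) P x) t
  unfold armProb
  rw [h t, h (!t)]
  cases t <;> simp

/-- The conditional probability of the binary confounder given the covariates. -/
def confounderWeight (b : Bool) (x : 𝒳) : ℝ :=
  (armProb P b x + Λ * armProb P (!b) x) / (1 + Λ)

/-- The conditional probability of arm `t` given the covariates and the binary confounder. -/
def treatmentWeight (t : Bool) (w : 𝒳 × Bool) : ℝ :=
  if w.2 = t then armProb P t w.1 / (armProb P t w.1 + Λ * armProb P (!t) w.1)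
  else Λ * armProb P t w.1 / (Λ * armProb P t w.1 + armProb P (!t) w.1)

lemma measurable_confounderWeight (b : Bool) : Measurable (confounderWeight Λ P b) := by
  have := fun t => measurable_armProb P t
  unfold confounderWeight; fun_prop

lemma measurable_treatmentWeight (t : Bool) : Measurable (treatmentWeight Λ P t) := by
  have := fun t => measurable_armProb P t
  refine Measurable.ite (measurable_snd (measurableSet_singleton t)) ?_ ?_ <;> fun_prop

/-- The joint law of the covariates and the binary confounder. -/
def confoundedLaw : Measure (𝒳 × Bool) :=
  P.map Prod.fst ⊗ₘ boolKernel (confounderWeight Λ P) (measurable_confounderWeight Λ P)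

/-- The joint law of the covariates and the encoded confounder. -/
def encodedLaw (k : ℕ) : Measure (𝒳 × (Fin k → ℝ)) := (confoundedLaw Λ P).map (encode k)

/-- The conditional law of the treatment given the covariates and the encoded confounder. -/
def treatmentKernel (k : ℕ) : Kernel (𝒳 × (Fin k → ℝ)) Bool :=
  (boolKernel (treatmentWeight Λ P) (measurable_treatmentWeight Λ P)).comap decode measurable_decode

/-- The conditional law of the potential outcome of arm `t`: the lower tail of the outcome law if
the binary confounder is `t`, and the upper tail otherwise. -/
def potentialKernel (k : ℕ) (t : Bool) : Kernel (𝒳 × (Fin k → ℝ)) ℝ :=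
  (tailKernel Λ P t).comap (fun v => ((decode v).1, (decode v).2 == t)) (by
    have h : Measurable fun b : Bool => b == t := measurable_from_top
    exact (measurable_fst.comp measurable_decode).prodMk
      (h.comp (measurable_snd.comp measurable_decode)))

/-- The law of covariates, confounder and potential outcomes under the worst-case law. -/
def outcomesLaw (k : ℕ) : Measure ((𝒳 × (Fin k → ℝ)) × (ℝ × ℝ)) :=
  encodedLaw Λ P k ⊗ₘ (potentialKernel Λ P k true ×ₖ potentialKernel Λ P k false)

/-- Rearranges covariates, confounder, potential outcomes and treatment to full data. -/
def assemble {𝒳 : Type*} {k : ℕ} (v : ((𝒳 × (Fin k → ℝ)) × (ℝ × ℝ)) × Bool) : Full 𝒳 k :=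
  (v.1.1.1, v.1.2.1, v.1.2.2, v.2, v.1.1.2)

lemma measurable_assemble {k : ℕ} :
    Measurable (assemble : ((𝒳 × (Fin k → ℝ)) × (ℝ × ℝ)) × Bool → Full 𝒳 k) := by
  unfold assemble; fun_prop

/-- The law of the full data under which the worst-case welfare of every policy is attained. -/
def worstCaseLaw (k : ℕ) : Measure (Full 𝒳 k) :=
  (outcomesLaw Λ P k ⊗ₘ (treatmentKernel Λ P k).prodMkRight (ℝ × ℝ)).map assemble

variable {k : ℕ}

lemma map_worstCaseLaw :
    (worstCaseLaw Λ P k).map (fun o => ((o.XU, o.outcomes), o.A)) =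
      outcomesLaw Λ P k ⊗ₘ (treatmentKernel Λ P k).prodMkRight (ℝ × ℝ) := by
  rw [worstCaseLaw, Measure.map_map
    ((Full.measurable_XU.prodMk Full.measurable_outcomes).prodMk Full.measurable_A)
    measurable_assemble]
  exact Measure.map_id

lemma lintegral_encodedLaw (hk : 1 ≤ k) {G : 𝒳 × Bool → ENNReal} (hG : Measurable G) :
    ∫⁻ v, G (decode v) ∂(encodedLaw Λ P k) = ∫⁻ w, G w ∂(confoundedLaw Λ P) := by
  have h := lintegral_map (μ := confoundedLaw Λ P) (hG.comp measurable_decode)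
    (measurable_encode (k := k))
  simp only [Function.comp_apply, decode_encode hk] at h
  exact h

variable [hΛ : Fact (1 ≤ Λ)]

/-- The sum is at least e_t + e_{!t} = 1, even at degenerate propensities, so the weights below
define Markov kernels at every x and not only almost everywhere. -/
lemma denominators_pos (t : Bool) (x : 𝒳) : 0 < armProb P t x + Λ * armProb P (!t) x := by
  have h1 := armProb_add_not P t x
  have h2 := armProb_nonneg P (!t) x
  nlinarith [hΛ.out]

instance : IsMarkovKernel
    (boolKernel (confounderWeight Λ P) (measurable_confounderWeight Λ P)) := by
  have hΛ1 : 0 < 1 + Λ := by linarith [hΛ.out]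
  refine isMarkovKernel_boolKernel _ (fun b x => ?_) fun x => ?_
  · exact div_nonneg (denominators_pos Λ P b x).le hΛ1.le
  · have := armProb_add_not P true x
    unfold confounderWeight
    rw [← add_div, div_eq_one_iff_eq hΛ1.ne']
    simp only [Bool.not_true, Bool.not_false] at *
    linear_combination (1 + Λ) * this

lemma treatmentWeight_nonneg (t : Bool) (w : 𝒳 × Bool) : 0 ≤ treatmentWeight Λ P t w := by
  have hΛ0 : 0 ≤ Λ := by linarith [hΛ.out]
  have := fun t => armProb_nonneg P t w.1
  unfold treatmentWeight
  split_ifs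
  · exact div_nonneg (this _) (add_nonneg (this _) (mul_nonneg hΛ0 (this _)))
  · exact div_nonneg (mul_nonneg hΛ0 (this _)) (add_nonneg (mul_nonneg hΛ0 (this _)) (this _))

instance : IsMarkovKernel (boolKernel (treatmentWeight Λ P) (measurable_treatmentWeight Λ P)) := by
  refine isMarkovKernel_boolKernel _ (treatmentWeight_nonneg Λ P) fun w => ?_
  have h1 := (denominators_pos Λ P true w.1).ne'
  have h2 := (denominators_pos Λ P false w.1).ne'
  simp only [Bool.not_true, Bool.not_false] at h1 h2
  unfold treatmentWeight
  cases h : w.2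
  · simp only [Bool.false_eq_true, if_false, if_true, Bool.not_true, Bool.not_false]
    rw [add_comm (Λ * _), ← add_div, div_eq_one_iff_eq h2]
    ring
  · simp only [Bool.true_eq_false, if_false, if_true, Bool.not_true, Bool.not_false]
    rw [add_comm (Λ * _), ← add_div, div_eq_one_iff_eq h1]

instance : IsProbabilityMeasure (confoundedLaw Λ P) := by
  unfold confoundedLaw; infer_instance

instance : IsProbabilityMeasure (encodedLaw Λ P k) :=
  Measure.isProbabilityMeasure_map measurable_encode.aemeasurable

instance : IsMarkovKernel (treatmentKernel Λ P k) := by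
  unfold treatmentKernel; infer_instance

instance (t : Bool) : IsMarkovKernel (potentialKernel Λ P k t) := by
  have := isMarkovKernel_tailKernel P hΛ.out t
  unfold potentialKernel; infer_instance

instance : IsProbabilityMeasure (outcomesLaw Λ P k) := by
  unfold outcomesLaw; infer_instance

instance : IsProbabilityMeasure (worstCaseLaw Λ P k) :=
  Measure.isProbabilityMeasure_map measurable_assemble.aemeasurable

lemma map_worstCaseLaw_outcomes :
    (worstCaseLaw Λ P k).map (fun o => (o.XU, o.outcomes)) = outcomesLaw Λ P k := by
  have h := congrArg (Measure.map Prod.fst) (map_worstCaseLaw Λ P (k := k))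
  rw [Measure.map_map measurable_fst
    ((Full.measurable_XU.prodMk Full.measurable_outcomes).prodMk Full.measurable_A)] at h
  exact h.trans (Measure.fst_compProd _ _)

lemma map_worstCaseLaw_XU : (worstCaseLaw Λ P k).map Full.XU = encodedLaw Λ P k := by
  have h := congrArg (Measure.map Prod.fst) (map_worstCaseLaw_outcomes Λ P (k := k))
  rw [Measure.map_map measurable_fst
    (Full.measurable_XU.prodMk Full.measurable_outcomes)] at h
  exact h.trans (Measure.fst_compProd _ _)

/-- The treatment kernel does not read the outcomes, so they integrate out with total mass one. -/
lemma condDistrib_worstCaseLaw :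
    condDistrib Full.A Full.XU (worstCaseLaw Λ P k) =ᵐ[encodedLaw Λ P k]
      treatmentKernel Λ P k := by
  rw [← map_worstCaseLaw_XU]
  refine condDistrib_ae_eq_of_measure_eq_compProd _ Full.measurable_A.aemeasurable ?_
  have h := congrArg (Measure.map fun v : ((𝒳 × (Fin k → ℝ)) × (ℝ × ℝ)) × Bool => (v.1.1, v.2))
    (map_worstCaseLaw Λ P (k := k))
  rw [Measure.map_map (by fun_prop)
    ((Full.measurable_XU.prodMk Full.measurable_outcomes).prodMk Full.measurable_A)] at h
  refine h.trans ?_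
  rw [map_worstCaseLaw_XU]
  refine Measure.ext_of_lintegral _ fun f hf => ?_
  rw [lintegral_map hf (by fun_prop), Measure.lintegral_compProd (by fun_prop), outcomesLaw,
    Measure.lintegral_compProd, Measure.lintegral_compProd hf]
  · refine lintegral_congr fun v => ?_
    simp
  · simp only [Kernel.prodMkRight_apply]
    exact (Measurable.lintegral_kernel_prod_right' hf (κ := treatmentKernel Λ P k)).comp
      measurable_fst

lemma condIndepFun_worstCaseLaw [StandardBorelSpace 𝒳] :
    CondIndepFun (MeasurableSpace.comap Full.XU inferInstance) Full.measurable_XU.comap_le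
      (Full.outcomes : Full 𝒳 k → ℝ × ℝ) Full.A (worstCaseLaw Λ P k) := by
  refine (condIndepFun_iff_condDistrib_prod_ae_eq_prodMkRight Full.measurable_A
    Full.measurable_outcomes Full.measurable_XU).2 ?_
  rw [condDistrib_ae_eq_iff_measure_eq_compProd _ Full.measurable_A.aemeasurable,
    map_worstCaseLaw, map_worstCaseLaw_outcomes]
  refine Measure.compProd_congr ?_
  have h := condDistrib_worstCaseLaw Λ P (k := k)
  have h2 : (outcomesLaw Λ P k).map Prod.fst = encodedLaw Λ P k := Measure.fst_compProd _ _
  rw [← h2] at h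
  filter_upwards [ae_of_ae_map measurable_fst.aemeasurable h] with v hv
  exact hv.symm

lemma ae_scoreProb_worstCaseLaw :
    ∀ᵐ o ∂(worstCaseLaw Λ P k), ∀ t, scoreProb (worstCaseLaw Λ P k) t o.XU =
      treatmentWeight Λ P t (decode o.XU) := by
  have h := condDistrib_worstCaseLaw Λ P (k := k)
  rw [← map_worstCaseLaw_XU] at h
  filter_upwards [ae_of_ae_map Full.measurable_XU.aemeasurable h] with o ho t
  rw [scoreProb, ho, treatmentKernel, Kernel.comap_apply, measureReal_def, boolKernel_singleton,
    ENNReal.toReal_ofReal (treatmentWeight_nonneg Λ P _ _)]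

lemma lintegral_outcomes (t : Bool) (v : 𝒳 × (Fin k → ℝ)) {f : ℝ → ENNReal} (hf : Measurable f) :
    ∫⁻ y, f (outcomeAt t y) ∂((potentialKernel Λ P k true ×ₖ potentialKernel Λ P k false) v) =
      ∫⁻ y, f y ∂(potentialKernel Λ P k t v) := by
  rw [Kernel.lintegral_prod _ _ _
    (by exact hf.comp (measurable_outcomeAt t) : Measurable fun y => f (outcomeAt t y))]
  cases t <;> simp [outcomeAt]

/-- Inside arm t the confounder equals t with probability 1/(1+Λ) given X, which are the proportions
in which the two tails mix to the outcome law. -/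
lemma map_restrict_worstCaseLaw (hk : 1 ≤ k) (t : Bool) :
    ((worstCaseLaw Λ P k).restrict (Full.A ⁻¹' {t})).map (fun o => (o.X, o.pot t)) =
      (armLaw P t).withDensity fun v => ENNReal.ofReal (armProb P t v.1) := by
  have hVm := Full.measurable_XU.prodMk (Full.measurable_outcomes (𝒳 := 𝒳) (k := k))
  have mw : Measurable fun v : (𝒳 × (Fin k → ℝ)) × (ℝ × ℝ) =>
      ENNReal.ofReal (((treatmentKernel Λ P k).prodMkRight (ℝ × ℝ) v).real {t}) :=
    ((Kernel.measurable_coe _ (by simp)).ennreal_toReal).ennreal_ofReal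
  have mat := measurable_outcomeAt t
  have me := measurable_armProb P t
  have H := map_restrict_arm_of_map_eq_compProd (Q := worstCaseLaw Λ P k) (t := t) hVm
    Full.measurable_A (κ := (treatmentKernel Λ P k).prodMkRight (ℝ × ℝ))
    (by rw [map_worstCaseLaw, map_worstCaseLaw_outcomes])
  rw [map_worstCaseLaw_outcomes] at H
  have hproj : Measurable fun v : (𝒳 × (Fin k → ℝ)) × (ℝ × ℝ) => (v.1.1, outcomeAt t v.2) := by
    fun_prop
  have e1 : (fun o : Full 𝒳 k => (o.X, o.pot t)) =
      (fun v : (𝒳 × (Fin k → ℝ)) × (ℝ × ℝ) => (v.1.1, outcomeAt t v.2)) ∘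
        fun o => (o.XU, o.outcomes) := by
    funext o
    simp only [Function.comp_apply, outcomeAt_outcomes]
    rfl
  rw [e1, ← Measure.map_map hproj hVm, H]
  refine Measure.ext_of_lintegral _ fun f hf => ?_
  rw [lintegral_map hf hproj, lintegral_withDensity_eq_lintegral_mul _ mw (by fun_prop),
    lintegral_withDensity_eq_lintegral_mul _ (by fun_prop) hf, outcomesLaw,
    Measure.lintegral_compProd (mw.mul (by fun_prop)), armLaw,
    Measure.lintegral_compProd (by fun_prop)]
  have e2 : ∀ v : 𝒳 × (Fin k → ℝ), ∫⁻ y,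
      ((fun v : (𝒳 × (Fin k → ℝ)) × (ℝ × ℝ) =>
        ENNReal.ofReal (((treatmentKernel Λ P k).prodMkRight (ℝ × ℝ) v).real {t})) *
        fun v : (𝒳 × (Fin k → ℝ)) × (ℝ × ℝ) => f (v.1.1, outcomeAt t v.2)) (v, y)
        ∂((potentialKernel Λ P k true ×ₖ potentialKernel Λ P k false) v) =
      (fun w : 𝒳 × Bool => ENNReal.ofReal (treatmentWeight Λ P t w) *
        ∫⁻ y, f (w.1, y) ∂(tailKernel Λ P t (w.1, w.2 == t))) (decode v) := by
    intro v
    simp only [Pi.mul_apply, Kernel.prodMkRight_apply]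
    rw [lintegral_const_mul _ (by fun_prop),
      lintegral_outcomes Λ P t v (f := fun y => f (v.1, y)) (by fun_prop), treatmentKernel,
      Kernel.comap_apply, measureReal_def, boolKernel_singleton,
      ENNReal.toReal_ofReal (treatmentWeight_nonneg Λ P _ _)]
    rfl
  have hmk := isMarkovKernel_tailKernel P hΛ.out t
  have mG : Measurable fun w : 𝒳 × Bool => ENNReal.ofReal (treatmentWeight Λ P t w) *
      ∫⁻ y, f (w.1, y) ∂(tailKernel Λ P t (w.1, w.2 == t)) := by
    have h1 : Measurable fun w : 𝒳 × Bool => ∫⁻ y, f (w.1, y) ∂(tailKernel Λ P t w) :=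
      Measurable.lintegral_kernel_prod_right' (f := fun p : (𝒳 × Bool) × ℝ => f (p.1.1, p.2))
        (by fun_prop)
    have h2 : Measurable fun b : Bool => b == t := measurable_from_top
    exact (measurable_treatmentWeight Λ P t).ennreal_ofReal.mul
      (h1.comp (measurable_fst.prodMk (h2.comp measurable_snd)))
  rw [lintegral_congr e2, lintegral_encodedLaw Λ P hk mG, confoundedLaw,
    Measure.lintegral_compProd mG]
  refine lintegral_congr fun x => ?_
  rw [lintegral_boolKernel]
  simp only [Pi.mul_apply]
  rw [lintegral_const_mul _ (by fun_prop), outcomeKernel_apply,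
    ← lintegral_tailKernel_mix P hΛ.out t x (by fun_prop : Measurable fun y => f (x, y))]
  have hΛ0 : 0 < Λ := by linarith [hΛ.out]
  have d1 := denominators_pos Λ P t x
  have d2 := denominators_pos Λ P (!t) x
  rw [Bool.not_not] at d2
  -- The confounder weight is, up to 1/(1+Λ), the denominator of the treatment weight; it was chosen
  -- for this cancellation.
  have a1 : confounderWeight Λ P t x * treatmentWeight Λ P t (x, t) =
      armProb P t x * (1 / (1 + Λ)) := by
    simp only [confounderWeight, treatmentWeight, if_true]
    field_simp
  have a2 : confounderWeight Λ P (!t) x * treatmentWeight Λ P t (x, !t) =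
      armProb P t x * (Λ / (1 + Λ)) := by
    simp only [confounderWeight, treatmentWeight, Bool.not_not, Bool.not_eq_self, if_false]
    rw [add_comm (Λ * _)]
    field_simp
  have c0 : ∀ b, 0 ≤ confounderWeight Λ P b x := fun b =>
    div_nonneg (denominators_pos Λ P b x).le (by positivity)
  have hsum : ∀ F : Bool → ENNReal, ∑ b, F b = F t + F (!t) := by
    intro F; cases t <;> simp [add_comm]
  rw [hsum, ← mul_assoc, ← mul_assoc, ← ENNReal.ofReal_mul (c0 _), ← ENNReal.ofReal_mul (c0 _),
    a1, a2, ENNReal.ofReal_mul (armProb_nonneg P t x), ENNReal.ofReal_mul (armProb_nonneg P t x),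
    mul_add, mul_assoc, mul_assoc]
  simp

end WorstCase

/-- Laws of the observed data that agree on each arm are equal. -/
lemma obs_measure_ext {𝒳 : Type*} [MeasurableSpace 𝒳] {R S : Measure (Obs 𝒳)}
    (h : ∀ t, (R.restrict ((fun z : Obs 𝒳 => z.2.2) ⁻¹' {t})).map
        (fun z : Obs 𝒳 => (z.1, z.2.1)) =
      (S.restrict ((fun z : Obs 𝒳 => z.2.2) ⁻¹' {t})).map (fun z : Obs 𝒳 => (z.1, z.2.1))) :
    R = S := by
  ext s hs
  have hA : Measurable fun z : Obs 𝒳 => z.2.2 := by fun_prop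
  have hV : Measurable fun z : Obs 𝒳 => (z.1, z.2.1) := by fun_prop
  have hsplit : ∀ T : Measure (Obs 𝒳), T s = ∑ t,
      (T.restrict ((fun z : Obs 𝒳 => z.2.2) ⁻¹' {t})).map (fun z : Obs 𝒳 => (z.1, z.2.1))
        {v | (v.1, v.2, t) ∈ s} := by
    intro T
    have hms : ∀ t, MeasurableSet {v : 𝒳 × ℝ | (v.1, v.2, t) ∈ s} := fun t =>
      (by fun_prop : Measurable fun v : 𝒳 × ℝ => (v.1, v.2, t)) hs
    have hterm : ∀ t, (T.restrict ((fun z : Obs 𝒳 => z.2.2) ⁻¹' {t})).map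
        (fun z : Obs 𝒳 => (z.1, z.2.1)) {v | (v.1, v.2, t) ∈ s} =
        T (s ∩ (fun z : Obs 𝒳 => z.2.2) ⁻¹' {t}) := by
      intro t
      rw [Measure.map_apply hV (hms t), Measure.restrict_apply (hV (hms t))]
      congr 1
      ext ⟨x, y, a⟩
      simp only [Set.mem_inter_iff, Set.mem_preimage, Set.mem_ofPred_eq, Set.mem_singleton_iff]
      constructor <;> rintro ⟨h1, rfl⟩ <;> exact ⟨h1, rfl⟩
    simp only [hterm, Fintype.sum_bool]
    rw [← measure_inter_add_sdiff s (hA (measurableSet_singleton true))]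
    congr 2
    ext ⟨x, y, a⟩
    cases a <;> simp
  rw [hsplit R, hsplit S]
  simp only [h]

/-! ### The worst-case law lies in the uncertainty set and has no excess -/

section WorstCase

variable {𝒳 : Type*} [MeasurableSpace 𝒳] (Λ : ℝ) (P : Measure (Obs 𝒳)) [IsProbabilityMeasure P]
  [hΛ : Fact (1 ≤ Λ)] {k : ℕ}

/-- Only Y(t) is seen on A = t, so the joint law of the two potential outcomes is irrelevant and
`map_restrict_worstCaseLaw` settles each arm. -/
lemma map_obs_worstCaseLaw (hk : 1 ≤ k) : (worstCaseLaw Λ P k).map Full.obs = P := by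
  refine obs_measure_ext fun t => ?_
  have hA : Measurable fun z : Obs 𝒳 => z.2.2 := by fun_prop
  have hV : Measurable fun z : Obs 𝒳 => (z.1, z.2.1) := by fun_prop
  rw [map_restrict_arm P t, ← map_restrict_worstCaseLaw Λ P hk t,
    Measure.restrict_map Full.measurable_obs (hA (measurableSet_singleton t)),
    Measure.map_map hV Full.measurable_obs]
  refine Measure.map_congr ?_
  refine (ae_restrict_iff' (Full.measurable_A (measurableSet_singleton t))).2
    (ae_of_all _ fun o ho => ?_)
  have ho' : o.A = t := ho
  subst ho'
  rfl

lemma ae_pot_worstCaseLaw (t : Bool) :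
    ∀ᵐ o ∂(worstCaseLaw Λ P k),
      ((decode o.XU).2 = t → o.pot t ≤ lowerQuantile Λ P o.X t) ∧
      ((decode o.XU).2 ≠ t → lowerQuantile Λ P o.X t ≤ o.pot t) := by
  have mq := measurable_lowerQuantile P hΛ.out t
  have mat := measurable_outcomeAt t
  have md := measurable_decode (𝒳 := 𝒳) (k := k)
  set p : (𝒳 × (Fin k → ℝ)) × ℝ → Prop := fun w =>
    ((decode w.1).2 = t → w.2 ≤ lowerQuantile Λ P w.1.1 t) ∧
      ((decode w.1).2 ≠ t → lowerQuantile Λ P w.1.1 t ≤ w.2) with hp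
  have hpm : MeasurableSet {w | p w} := by
    have h1 : MeasurableSet {w : (𝒳 × (Fin k → ℝ)) × ℝ | (decode w.1).2 = t} :=
      (measurable_snd.comp (md.comp measurable_fst)) (measurableSet_singleton t)
    have h2 : MeasurableSet {w : (𝒳 × (Fin k → ℝ)) × ℝ | w.2 ≤ lowerQuantile Λ P w.1.1 t} :=
      measurableSet_le (by fun_prop) (by fun_prop)
    have h3 : MeasurableSet {w : (𝒳 × (Fin k → ℝ)) × ℝ | lowerQuantile Λ P w.1.1 t ≤ w.2} :=
      measurableSet_le (by fun_prop) (by fun_prop)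
    exact (h1.imp h2).inter (h1.compl.imp h3)
  have h1 : ∀ v : 𝒳 × (Fin k → ℝ), ∀ᵐ y ∂(potentialKernel Λ P k t v), p (v, y) := by
    intro v
    filter_upwards [ae_tailKernel P hΛ.out t ((decode v).1, (decode v).2 == t)] with y hy
    refine ⟨fun h => hy.1 (by simpa using h), fun h => hy.2 (by simpa using h)⟩
  have h2 : ∀ v : 𝒳 × (Fin k → ℝ),
      ((potentialKernel Λ P k true ×ₖ potentialKernel Λ P k false) v).map (outcomeAt t) =
        potentialKernel Λ P k t v := by
    intro v
    refine Measure.ext_of_lintegral _ fun f hf => ?_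
    rw [lintegral_map hf mat, lintegral_outcomes Λ P t v hf]
  have h3 : ∀ᵐ w ∂(outcomesLaw Λ P k), p (w.1, outcomeAt t w.2) := by
    refine Measure.ae_compProd_of_ae_ae
      ((by fun_prop : Measurable fun w : (𝒳 × (Fin k → ℝ)) × (ℝ × ℝ) =>
        (w.1, outcomeAt t w.2)) hpm) (ae_of_all _ fun v => ?_)
    have := h1 v
    rw [← h2 v] at this
    exact ae_of_ae_map mat.aemeasurable this
  rw [← map_worstCaseLaw_outcomes] at h3
  filter_upwards [ae_of_ae_map
    (Full.measurable_XU.prodMk Full.measurable_outcomes).aemeasurable h3] with o ho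
  rw [outcomeAt_outcomes] at ho
  exact ho

/-- The odds ratio takes only the two extreme values that the model allows. -/
lemma odds_treatmentWeight (w : 𝒳 × Bool) (hpos : ∀ t, 0 < armProb P t w.1) :
    odds (treatmentWeight Λ P true w) / odds (nominalPropensity P w.1) =
      if w.2 then Λ⁻¹ else Λ := by
  have hΛ0 : 0 < Λ := by linarith [hΛ.out]
  have h1 := hpos true
  have h0 := hpos false
  have hn : nominalPropensity P w.1 = armProb P true w.1 := rfl
  have hs := armProb_add_not P true w.1
  rw [Bool.not_true] at hs
  have h0' : 1 - armProb P true w.1 = armProb P false w.1 := by linarith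
  have d1 := denominators_pos Λ P true w.1
  have d2 := denominators_pos Λ P false w.1
  simp only [Bool.not_true, Bool.not_false] at d1 d2
  rw [hn]
  unfold odds
  rw [h0']
  cases hb : w.2
  · have e1 : treatmentWeight Λ P true w = Λ * armProb P true w.1 /
        (Λ * armProb P true w.1 + armProb P false w.1) := by simp [treatmentWeight, hb]
    rw [add_comm] at d2
    have e2 : 1 - treatmentWeight Λ P true w = armProb P false w.1 /
        (Λ * armProb P true w.1 + armProb P false w.1) := by
      rw [e1]; field_simp; ring
    rw [e2, e1]
    simp only [Bool.false_eq_true, if_false]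
    field_simp
  · have e1 : treatmentWeight Λ P true w = armProb P true w.1 /
        (armProb P true w.1 + Λ * armProb P false w.1) := by simp [treatmentWeight, hb]
    have e2 : 1 - treatmentWeight Λ P true w = Λ * armProb P false w.1 /
        (armProb P true w.1 + Λ * armProb P false w.1) := by
      rw [e1]; field_simp; ring
    rw [e2, e1]
    simp only [if_true]
    field_simp

variable {P} [StandardBorelSpace 𝒳]

lemma isMSM_worstCaseLaw (hk : 1 ≤ k)
    (hpos : ∀ᵐ x ∂(P.map Prod.fst), ∀ t, 0 < armProb P t x) : IsMSM Λ (worstCaseLaw Λ P k) where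
  condIndep := condIndepFun_worstCaseLaw Λ P
  oddsRatio := by
    have hP := map_obs_worstCaseLaw Λ P hk
    have hpm : MeasurableSet {x | ∀ t, 0 < armProb P t x} := by
      simp only [Bool.forall_bool]
      exact (measurableSet_lt measurable_const (measurable_armProb P _)).inter
        (measurableSet_lt measurable_const (measurable_armProb P _))
    filter_upwards [ae_scoreProb_worstCaseLaw Λ P, (ae_obs_of_ae_X hP hpm).2 hpos] with o h1 h2
    have e1 : truePropensity (worstCaseLaw Λ P k) o.XU =
        treatmentWeight Λ P true (decode o.XU) := h1 true
    rw [e1, fullNominalPropensity_eq _ P hP]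
    have h3 := odds_treatmentWeight Λ P (decode o.XU) h2
    have hX : (decode o.XU).1 = o.X := rfl
    rw [hX] at h3
    rw [h3, one_div]
    have hle := inv_le_self_of_one_le hΛ.out
    split_ifs
    · exact ⟨le_rfl, hle⟩
    · exact ⟨hle, le_rfl⟩

/-- Equality case of `mul_tilt_le`: the inverse weight is the largest possible when Y(t) lies in the
lower tail and the smallest possible when it lies in the upper tail. -/
lemma ae_excess_worstCaseLaw (hk : 1 ≤ k)
    (hpos : ∀ᵐ x ∂(P.map Prod.fst), ∀ t, 0 < armProb P t x) (t : Bool) :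
    ∀ᵐ o ∂(worstCaseLaw Λ P k), excess Λ P (worstCaseLaw Λ P k) t o = 0 := by
  have hP := map_obs_worstCaseLaw Λ P hk
  filter_upwards [ae_scoreProb_worstCaseLaw Λ P, ae_pot_worstCaseLaw Λ P t,
    (isMSM_worstCaseLaw Λ hk hpos).ae_bounds hΛ.out P hP] with o h1 h2 h3
  have hΛ0 : 0 < Λ := by linarith [hΛ.out]
  have hX : (decode o.XU).1 = o.X := rfl
  have hs := armProb_add_not P t o.X
  have hp := (h3 t).2.1
  have hq := (h3 (!t)).2.1
  have d1 := denominators_pos Λ P t o.X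
  unfold excess
  rw [h1 t]
  by_cases hb : (decode o.XU).2 = t
  · rw [tilt_of_ge hΛ.out (h2.1 hb)]
    simp only [treatmentWeight, if_pos hb, hX]
    have e1 : 1 / (armProb P t o.X / (armProb P t o.X + Λ * armProb P (!t) o.X)) - 1 =
        Λ * (armProb P (!t) o.X / armProb P t o.X) := by field_simp; ring
    have e2 : 1 / armProb P t o.X - 1 = armProb P (!t) o.X / armProb P t o.X := by
      field_simp; linarith
    rw [e1, e2]
    ring
  · rw [tilt_of_le hΛ.out (h2.2 hb)]
    simp only [treatmentWeight, if_neg hb, hX]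
    have e1 : 1 / (Λ * armProb P t o.X / (Λ * armProb P t o.X + armProb P (!t) o.X)) - 1 =
        Λ⁻¹ * (armProb P (!t) o.X / armProb P t o.X) := by field_simp; ring
    have e2 : 1 / armProb P t o.X - 1 = armProb P (!t) o.X / armProb P t o.X := by
      field_simp; linarith
    rw [e1, e2]
    ring

end WorstCase

/-! ### Sharpness of the bound -/

section Identification

variable {𝒳 : Type*} [MeasurableSpace 𝒳] [StandardBorelSpace 𝒳] {Λ : ℝ} {P : Measure (Obs 𝒳)}
  [IsProbabilityMeasure P] {k : ℕ}

lemma isLeast_armValue (hΛ : 1 ≤ Λ) (hk : 1 ≤ k)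
    (hpos : ∀ᵐ x ∂(P.map Prod.fst), ∀ t, 0 < armProb P t x)
    (hy : ∀ t, Integrable (fun v : 𝒳 × ℝ => v.2) (armLaw P t))
    {π : 𝒳 → ℝ} (hπ : Measurable π) (hπ01 : ∀ x, π x ∈ Set.Icc (0 : ℝ) 1) :
    IsLeast ((fun Q : Measure (Full 𝒳 k) => ∫ o, Full.policyOutcome π o ∂Q) ''
      uncertaintySet k Λ P) (∑ t, armValue Λ P π t) := by
  have : Fact (1 ≤ Λ) := ⟨hΛ⟩
  constructor
  · have hP := map_obs_worstCaseLaw Λ P hk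
    have hM := isMSM_worstCaseLaw Λ hk hpos
    refine ⟨worstCaseLaw Λ P k, ⟨inferInstance, hM, hP⟩, ?_⟩
    simp only
    rw [(hM.integral_policyOutcome hΛ hP
      (fun t => (hM.integrable_pot_iff hΛ hP t).2 (hy t)) hπ hπ01).2, add_eq_left]
    refine Finset.sum_eq_zero fun t _ => ?_
    rw [← integral_zero (Full 𝒳 k) ℝ (μ := worstCaseLaw Λ P k)]
    refine integral_congr_ae ?_
    filter_upwards [ae_excess_worstCaseLaw Λ hk hpos t] with o ho
    rw [ho, mul_zero]
  · rintro _ ⟨Q, ⟨hQ, hM, hP⟩, rfl⟩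
    exact hM.sum_armValue_le hΛ hP (fun t => (hM.integrable_pot_iff hΛ hP t).2 (hy t)) hπ hπ01

end Identification

lemma integrable_fun_sub {α : Type*} [MeasurableSpace α] {μ : Measure α} {f g : α → ℝ}
    (hf : Integrable f μ) (hg : Integrable g μ) : Integrable (fun a => f a - g a) μ :=
  hf.sub hg

/-! ### First-order condition at the quantile -/

section TiltDerivative

variable {Λ : ℝ}

/-- The derivative of `q ↦ tilt Λ y q + q` away from `q = y`. -/
def tiltSlope (Λ y q : ℝ) : ℝ :=
  1 - Λ * (Set.Iio q).indicator 1 y - Λ⁻¹ * (Set.Ioi q).indicator 1 y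

lemma abs_tilt_add_sub_le (hΛ : 1 ≤ Λ) (y q q' : ℝ) :
    |(tilt Λ y q + q) - (tilt Λ y q' + q')| ≤ (Λ + 1) * |q - q'| := by
  rw [show (tilt Λ y q + q) - (tilt Λ y q' + q') = (tilt Λ y q - tilt Λ y q') + (q - q') by ring]
  refine (abs_add_le _ _).trans ?_
  rw [add_mul, one_mul]
  exact add_le_add_left (abs_tilt_sub_le hΛ y q q') _

lemma hasDerivAt_tilt_add (hΛ : 1 ≤ Λ) {y q : ℝ} (h : y ≠ q) :
    HasDerivAt (fun c => tilt Λ y c + c) (tiltSlope Λ y q) q := by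
  rcases lt_or_gt_of_ne h with h | h
  · have e : (fun c => tilt Λ y c + c) =ᶠ[𝓝 q] fun c => Λ * (y - c) + c := by
      filter_upwards [lt_mem_nhds h] with c hc
      rw [tilt_of_ge hΛ hc.le]
    refine HasDerivAt.congr_of_eventuallyEq ?_ e
    have hs : tiltSlope Λ y q = Λ * -1 + 1 := by simp [tiltSlope, h, h.le]; ring
    rw [hs]
    exact (((hasDerivAt_id q).const_sub y).const_mul Λ).add (hasDerivAt_id q)
  · have e : (fun c => tilt Λ y c + c) =ᶠ[𝓝 q] fun c => Λ⁻¹ * (y - c) + c := by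
      filter_upwards [gt_mem_nhds h] with c hc
      rw [tilt_of_le hΛ hc.le]
    refine HasDerivAt.congr_of_eventuallyEq ?_ e
    have hs : tiltSlope Λ y q = Λ⁻¹ * -1 + 1 := by simp [tiltSlope, h, h.le]; ring
    rw [hs]
    exact (((hasDerivAt_id q).const_sub y).const_mul Λ⁻¹).add (hasDerivAt_id q)

variable (ρ : Measure ℝ) [IsProbabilityMeasure ρ]

lemma measureReal_tails (hΛ : 1 ≤ Λ) (h : ρ {quantile Λ ρ} = 0) :
    ρ.real (Set.Iio (quantile Λ ρ)) = 1 / (1 + Λ) ∧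
      ρ.real (Set.Ioi (quantile Λ ρ)) = Λ / (1 + Λ) := by
  have h0 : ρ.real {quantile Λ ρ} = 0 := by simp [measureReal_def, h]
  have h1 := (atomShare_mem ρ hΛ).2
  rw [h0, mul_zero, add_zero] at h1
  refine ⟨h1, ?_⟩
  rw [← Set.compl_Iic, probReal_compl_eq_one_sub measurableSet_Iic, ← Set.Iio_union_right,
    measureReal_union (by simp) (measurableSet_singleton _), h0, h1]
  have : 1 + Λ ≠ 0 := by positivity
  field_simp
  ring

/-- Without an atom the two tails have masses 1/(1+Λ) and Λ/(1+Λ), and 1 - Λ/(1+Λ) - 1/(1+Λ) = 0.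
This is why the level 1/(1+Λ) is the right one. -/
lemma integral_tiltSlope (hΛ : 1 ≤ Λ) (h : ρ {quantile Λ ρ} = 0) :
    ∫ y, tiltSlope Λ y (quantile Λ ρ) ∂ρ = 0 := by
  have hi : ∀ S : Set ℝ, MeasurableSet S → Integrable (S.indicator (1 : ℝ → ℝ)) ρ := fun S hS =>
    (integrable_const (1 : ℝ)).indicator hS
  have h1 := (hi _ (measurableSet_Iio (a := quantile Λ ρ))).const_mul Λ
  have h2 := (hi _ (measurableSet_Ioi (a := quantile Λ ρ))).const_mul Λ⁻¹
  unfold tiltSlope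
  rw [integral_sub (integrable_fun_sub (integrable_const _) h1) h2,
    integral_sub (integrable_const _) h1,
    integral_const_mul, integral_const_mul, integral_indicator_one measurableSet_Iio,
    integral_indicator_one measurableSet_Ioi, (measureReal_tails ρ hΛ h).1,
    (measureReal_tails ρ hΛ h).2]
  have : 1 + Λ ≠ 0 := by positivity
  have : Λ ≠ 0 := by positivity
  simp
  field_simp
  ring

/-- Pointwise, the integrand is the tilted outcome plus q times the slope, and the slope has mean
zero. -/
lemma integral_tilt_add (hΛ : 1 ≤ Λ) (h : ρ {quantile Λ ρ} = 0)
    (hy : Integrable (fun y : ℝ => y) ρ) :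
    ∫ y, (tilt Λ y (quantile Λ ρ) + quantile Λ ρ) ∂ρ =
      Λ * ∫ y in Set.Iio (quantile Λ ρ), y ∂ρ + Λ⁻¹ * ∫ y in Set.Ioi (quantile Λ ρ), y ∂ρ := by
  set q := quantile Λ ρ with hq
  have e : ∀ y, tilt Λ y q + q = Λ * (Set.Iio q).indicator (fun y => y) y +
      Λ⁻¹ * (Set.Ioi q).indicator (fun y => y) y + q * tiltSlope Λ y q := by
    intro y
    rcases lt_trichotomy y q with hlt | heq | hgt
    · rw [tilt_of_ge hΛ hlt.le]; simp [tiltSlope, hlt, hlt.le]; ring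
    · rw [tilt_of_ge hΛ heq.le]; simp [tiltSlope, heq]
    · rw [tilt_of_le hΛ hgt.le]; simp [tiltSlope, hgt, hgt.le]; ring
  have i1 := (hy.indicator (measurableSet_Iio (a := q))).const_mul Λ
  have i2 := (hy.indicator (measurableSet_Ioi (a := q))).const_mul Λ⁻¹
  have i3 : Integrable (fun y => q * tiltSlope Λ y q) ρ := by
    have hi : ∀ S : Set ℝ, MeasurableSet S → Integrable (S.indicator (1 : ℝ → ℝ)) ρ :=
      fun S hS => (integrable_const (1 : ℝ)).indicator hS
    exact (((integrable_const _).sub ((hi _ measurableSet_Iio).const_mul Λ)).sub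
      ((hi _ measurableSet_Ioi).const_mul Λ⁻¹)).const_mul q
  simp_rw [e]
  rw [integral_add (i1.fun_add i2) i3, integral_add i1 i2, integral_const_mul, integral_const_mul,
    integral_const_mul, integral_tiltSlope ρ hΛ h, mul_zero, add_zero,
    integral_indicator measurableSet_Iio, integral_indicator measurableSet_Ioi]

end TiltDerivative

/-! ### Differentiation of the averaged score -/

section Orthogonality

variable {𝒳 : Type*} [MeasurableSpace 𝒳] {Λ : ℝ} {P : Measure (Obs 𝒳)} [IsProbabilityMeasure P]
  {t : Bool}

/-- The bracket has conditional mean zero given X by `integral_tilt_add`, so any bounded function of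
X may multiply it. Errors in the propensity enter through such a factor. -/
lemma integral_mul_tilt_sub_rho (hΛ : 1 ≤ Λ)
    (hy : Integrable (fun v : 𝒳 × ℝ => v.2) (armLaw P t))
    (hatom : ∀ᵐ x ∂(P.map Prod.fst), outcomeLaw P x t {lowerQuantile Λ P x t} = 0)
    {c : 𝒳 → ℝ} (hc : Measurable c) {C : ℝ} (hC : ∀ᵐ x ∂(P.map Prod.fst), |c x| ≤ C) :
    Integrable (fun v : 𝒳 × ℝ => c v.1 * (tilt Λ v.2 (lowerQuantile Λ P v.1 t) +
      lowerQuantile Λ P v.1 t - (trueNuisance Λ P).rho Λ t v.1)) (armLaw P t) ∧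
    ∫ v : 𝒳 × ℝ, c v.1 * (tilt Λ v.2 (lowerQuantile Λ P v.1 t) +
      lowerQuantile Λ P v.1 t - (trueNuisance Λ P).rho Λ t v.1) ∂(armLaw P t) = 0 := by
  have mq := measurable_lowerQuantile P hΛ t
  have iq := integrable_lowerQuantile hy hΛ
  have i0 := integrable_tilt_add hΛ hy mq iq
  have i1 := integrable_bdd_mul hc hC (integrable_fun_sub i0
    (regular_trueNuisance hΛ hy).integrable_rho)
  refine ⟨i1, ?_⟩
  have hy' := hy
  rw [armLaw] at i0 i1 hy' ⊢
  rw [Measure.integral_compProd i1]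
  rw [← integral_zero 𝒳 ℝ (μ := P.map Prod.fst)]
  refine integral_congr_ae ?_
  have hi0 := ((Measure.integrable_compProd_iff i0.1).1 i0).1
  have hiy := ((Measure.integrable_compProd_iff hy'.1).1 hy').1
  filter_upwards [hatom, hi0, hiy] with x h1 h2 h3
  rw [integral_const_mul, integral_sub h2 (integrable_const _), integral_const, probReal_univ,
    one_smul]
  have := integral_tilt_add (outcomeLaw P x t) hΛ h1 h3
  simp only [quantile_outcomeLaw] at this
  rw [outcomeKernel_apply, this]
  simp [Nuisance.rho, trueNuisance]

lemma measurable_tiltSlope (hΛ : 1 ≤ Λ) :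
    Measurable fun v : 𝒳 × ℝ => tiltSlope Λ v.2 (lowerQuantile Λ P v.1 t) := by
  have mq : Measurable fun v : 𝒳 × ℝ => lowerQuantile Λ P v.1 t :=
    (measurable_lowerQuantile P hΛ t).comp measurable_fst
  have h1 : Measurable fun v : 𝒳 × ℝ =>
      (Set.Iio (lowerQuantile Λ P v.1 t)).indicator (1 : ℝ → ℝ) v.2 :=
    (measurable_one (α := ℝ)).indicator (measurableSet_lt measurable_snd mq)
  have h2 : Measurable fun v : 𝒳 × ℝ =>
      (Set.Ioi (lowerQuantile Λ P v.1 t)).indicator (1 : ℝ → ℝ) v.2 :=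
    (measurable_one (α := ℝ)).indicator (measurableSet_lt mq measurable_snd)
  unfold tiltSlope
  fun_prop

lemma abs_tiltSlope_le (hΛ : 1 ≤ Λ) (y q : ℝ) : |tiltSlope Λ y q| ≤ Λ + 1 := by
  have h1 : 0 < Λ⁻¹ := by positivity
  have h2 : Λ⁻¹ ≤ 1 := inv_le_one_of_one_le₀ hΛ
  rw [abs_le]
  rcases lt_trichotomy y q with h | h | h
  · simp only [tiltSlope, Set.indicator, Set.mem_Iio, Set.mem_Ioi, h, h.le, not_lt.2, if_true,
      if_false, Pi.one_apply]; constructor <;> linarith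
  · simp only [tiltSlope, Set.indicator, Set.mem_Iio, Set.mem_Ioi, h, lt_irrefl,
      if_false]; constructor <;> linarith
  · simp only [tiltSlope, Set.indicator, Set.mem_Iio, Set.mem_Ioi, h, h.le, not_lt.2, if_true,
      if_false, Pi.one_apply]; constructor <;> linarith

lemma integral_mul_tiltSlope (hΛ : 1 ≤ Λ)
    (hatom : ∀ᵐ x ∂(P.map Prod.fst), outcomeLaw P x t {lowerQuantile Λ P x t} = 0)
    {c : 𝒳 → ℝ} (hc : Integrable (fun v : 𝒳 × ℝ => c v.1) (armLaw P t)) :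
    ∫ v : 𝒳 × ℝ, c v.1 * tiltSlope Λ v.2 (lowerQuantile Λ P v.1 t) ∂(armLaw P t) = 0 := by
  have i1 : Integrable (fun v : 𝒳 × ℝ => c v.1 * tiltSlope Λ v.2 (lowerQuantile Λ P v.1 t))
      (armLaw P t) := by
    exact hc.mul_bdd (measurable_tiltSlope hΛ).aestronglyMeasurable
      (ae_of_all _ fun v => abs_tiltSlope_le hΛ _ _)
  rw [armLaw] at i1 ⊢
  rw [Measure.integral_compProd i1, ← integral_zero 𝒳 ℝ (μ := P.map Prod.fst)]
  refine integral_congr_ae ?_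
  filter_upwards [hatom] with x h1
  rw [integral_const_mul]
  have := integral_tiltSlope (outcomeLaw P x t) hΛ h1
  rw [quantile_outcomeLaw] at this
  rw [outcomeKernel_apply, this, mul_zero]

/-- The difference quotient at `0` of the averaged score, up to terms of conditional mean zero. -/
def scoreSlope (Λ : ℝ) (P : Measure (Obs 𝒳)) [IsProbabilityMeasure P] (η' : Nuisance 𝒳) (t : Bool)
    (r : ℝ) (v : 𝒳 × ℝ) : ℝ :=
  (armProb P t v.1 / ((trueNuisance Λ P).path η' r).eT t v.1 - armProb P t v.1) *
    (r⁻¹ * ((tilt Λ v.2 (((trueNuisance Λ P).path η' r).q v.1 t) +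
      ((trueNuisance Λ P).path η' r).q v.1 t) -
      (tilt Λ v.2 (lowerQuantile Λ P v.1 t) + lowerQuantile Λ P v.1 t))) -
  (armProb P t v.1 / ((trueNuisance Λ P).path η' r).eT t v.1 - 1) *
    (η'.rho Λ t v.1 - (trueNuisance Λ P).rho Λ t v.1)

/-- Isolates the part of the increment that is not divided safely by r: it is a function of X times
a quantity of conditional mean zero, so it disappears exactly, before any limit. -/
lemma meanScore_path_sub {η' : Nuisance 𝒳} {r : ℝ} (hr : r ≠ 0) (v : 𝒳 × ℝ)
    (hpos : 0 < armProb P t v.1) :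
    meanScore Λ (armProb P t) ((trueNuisance Λ P).path η' r) t v -
      meanScore Λ (armProb P t) (trueNuisance Λ P) t v =
    r * scoreSlope Λ P η' t r v +
      (armProb P t v.1 / ((trueNuisance Λ P).path η' r).eT t v.1 - 1) *
      (tilt Λ v.2 (lowerQuantile Λ P v.1 t) + lowerQuantile Λ P v.1 t -
        (trueNuisance Λ P).rho Λ t v.1) := by
  have hq : (trueNuisance Λ P).q v.1 t = lowerQuantile Λ P v.1 t := rfl
  unfold meanScore scoreSlope
  rw [← armProb_eq P Λ t v.1, div_self hpos.ne', Nuisance.path_rho, hq]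
  field_simp
  ring

/-- Dominated convergence for `scoreSlope`. The set `S` is left free so that one argument covers the
one-sided and the two-sided derivative. -/
lemma hasDerivWithinAt_integral_meanScore (hΛ : 1 ≤ Λ)
    (hy : Integrable (fun v : 𝒳 × ℝ => v.2) (armLaw P t))
    (hpos : ∀ᵐ x ∂(P.map Prod.fst), ∀ t, 0 < armProb P t x)
    (hatom : ∀ᵐ x ∂(P.map Prod.fst), outcomeLaw P x t {lowerQuantile Λ P x t} = 0)
    {π : 𝒳 → ℝ} (hπ : Measurable π) (hπ01 : ∀ x, π x ∈ Set.Icc (0 : ℝ) 1)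
    {η' : Nuisance 𝒳} (hη' : η'.Regular Λ P t) {C : ℝ} (hC0 : 0 < C) {S : Set ℝ}
    (hC : ∀ᶠ r in 𝓝[S] (0 : ℝ), ∀ᵐ x ∂(P.map Prod.fst),
      armProb P t x ≤ C * ((trueNuisance Λ P).path η' r).eT t x) :
    HasDerivWithinAt (fun r => ∫ v, policyProb π t v.1 *
      meanScore Λ (armProb P t) ((trueNuisance Λ P).path η' r) t v ∂(armLaw P t)) 0 S 0 := by
  have hη := regular_trueNuisance hΛ hy
  have mp := measurable_policyProb hπ t
  have me := measurable_armProb P t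
  have mq := measurable_lowerQuantile P hΛ t
  have iq := integrable_lowerQuantile hy hΛ
  have m3 := hη.measurable_rho
  have m4 := hη'.measurable_rho
  have m5 := hη'.measurable_q
  have hp1 : ∀ x, |policyProb π t x| ≤ 1 := fun x =>
    abs_le.2 ⟨by linarith [(policyProb_mem hπ01 t x).1], (policyProb_mem hπ01 t x).2⟩
  have he1 : ∀ x, |armProb P t x| ≤ 1 := fun x =>
    abs_le.2 ⟨by linarith [armProb_nonneg P t x], armProb_le_one P t x⟩
  have he2 : ∀ x, |1 - armProb P t x| ≤ 1 := fun x =>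
    abs_le.2 ⟨by linarith [armProb_le_one P t x], by linarith [armProb_nonneg P t x]⟩
  have hpath0 : (trueNuisance Λ P).path η' 0 = trueNuisance Λ P := by
    simp [Nuisance.path]
  set l := 𝓝[S \ {0}] (0 : ℝ) with hl
  have hCl : ∀ᶠ r in l, r ≠ 0 ∧ ∀ᵐ x ∂(P.map Prod.fst),
      0 < ((trueNuisance Λ P).path η' r).eT t x ∧
      |armProb P t x / ((trueNuisance Λ P).path η' r).eT t x| ≤ C := by
    filter_upwards [hC.filter_mono (nhdsWithin_mono 0 Set.sdiff_subset), self_mem_nhdsWithin]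
      with r h1 h2
    exact ⟨h2.2, ae_ratio_bounds hpos h1 hC0⟩
  rw [hasDerivWithinAt_iff_tendsto_slope]
  have key : ∀ᶠ r in l, slope (fun r => ∫ v, policyProb π t v.1 *
      meanScore Λ (armProb P t) ((trueNuisance Λ P).path η' r) t v ∂(armLaw P t)) 0 r =
      ∫ v, policyProb π t v.1 * scoreSlope Λ P η' t r v ∂(armLaw P t) := by
    filter_upwards [hCl, hC.filter_mono (nhdsWithin_mono 0 Set.sdiff_subset)] with r hr hr'
    have hreg := hη.path hη' r
    have m1 := hreg.measurable_eT
    have i1 := (hreg.integrable_phi hΛ hy hpos hC0 hr' hπ hπ01).2.1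
    have i0 := (hη.integrable_phi hΛ hy hpos one_pos
      (ae_of_all _ fun x => by rw [one_mul, armProb_eq P Λ]) hπ hπ01).2.1
    obtain ⟨i2, e2⟩ := integral_mul_tilt_sub_rho hΛ hy hatom
      (c := fun x => policyProb π t x *
        (armProb P t x / ((trueNuisance Λ P).path η' r).eT t x - 1)) (by fun_prop) (C := C + 1)
      (by
        filter_upwards [hr.2] with x hx
        rw [abs_mul]
        refine (mul_le_of_le_one_left (abs_nonneg _) (hp1 x)).trans ?_
        refine (abs_sub _ _).trans ?_
        rw [abs_one]
        exact add_le_add_left hx.2 1)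
    have e3 : (fun v => policyProb π t v.1 * scoreSlope Λ P η' t r v) =ᵐ[armLaw P t] fun v =>
        r⁻¹ * (policyProb π t v.1 *
          meanScore Λ (armProb P t) ((trueNuisance Λ P).path η' r) t v -
        policyProb π t v.1 * meanScore Λ (armProb P t) (trueNuisance Λ P) t v -
        policyProb π t v.1 *
        (armProb P t v.1 / ((trueNuisance Λ P).path η' r).eT t v.1 - 1) *
        (tilt Λ v.2 (lowerQuantile Λ P v.1 t) + lowerQuantile Λ P v.1 t -
        (trueNuisance Λ P).rho Λ t v.1)) := by
      filter_upwards [ae_armLaw_of_ae hpos] with v hv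
      rw [← mul_sub, meanScore_path_sub hr.1 v (hv t)]
      have := hr.1
      field_simp
      ring
    rw [integral_congr_ae e3, integral_const_mul, integral_sub (integrable_fun_sub i1 i0) i2, e2,
      integral_sub i1 i0, slope_def_field, sub_zero, sub_zero, hpath0]
    ring
  refine Tendsto.congr' (EventuallyEq.symm key) ?_
  -- The integrand is the pointwise limit of the quotients: e_t/ẽ_t tends to 1, so the ρ part dies
  -- and only the quantile direction survives, with mean zero.
  have hlim : ∫ v : 𝒳 × ℝ, (policyProb π t v.1 * (1 - armProb P t v.1) *
      (η'.q v.1 t - lowerQuantile Λ P v.1 t)) *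
      tiltSlope Λ v.2 (lowerQuantile Λ P v.1 t) ∂(armLaw P t) = 0 := by
    refine integral_mul_tiltSlope hΛ hatom (c := fun x => policyProb π t x *
      (1 - armProb P t x) * (η'.q x t - lowerQuantile Λ P x t)) ?_
    refine integrable_bdd_mul (c := fun x => policyProb π t x * (1 - armProb P t x))
      (by fun_prop) (C := 1) (ae_of_all _ fun x => ?_) (hη'.integrable_q.sub iq)
    rw [abs_mul]
    exact mul_le_one₀ (hp1 x) (abs_nonneg _) (he2 x)
  refine Eq.subst (motive := fun a => Tendsto _ l (𝓝 a)) hlim ?_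
  -- In the bound, C + 1 controls e_t/ẽ_t - e_t and e_t/ẽ_t - 1, and Λ + 1 is the Lipschitz constant
  -- of `tilt` + q; the factor r⁻¹ cancels the length of the step in q.
  refine tendsto_integral_filter_of_dominated_convergence
    (fun v => (C + 1) * ((Λ + 1) * |η'.q v.1 t - lowerQuantile Λ P v.1 t|) +
      (C + 1) * |η'.rho Λ t v.1 - (trueNuisance Λ P).rho Λ t v.1|) ?_ ?_ ?_ ?_
  · refine Eventually.of_forall fun r => ?_
    have hreg := hη.path hη' r
    have m1 := hreg.measurable_eT
    have m2 := hreg.measurable_q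
    have : Measurable fun v => policyProb π t v.1 * scoreSlope Λ P η' t r v := by
      unfold scoreSlope; fun_prop
    exact this.aestronglyMeasurable
  · filter_upwards [hCl] with r hr
    filter_upwards [ae_armLaw_of_ae hr.2] with v hv
    rw [norm_mul, Real.norm_eq_abs, Real.norm_eq_abs]
    refine (mul_le_of_le_one_left (abs_nonneg _) (hp1 v.1)).trans ?_
    unfold scoreSlope
    refine (abs_sub _ _).trans (add_le_add ?_ ?_)
    · rw [abs_mul]
      refine mul_le_mul ?_ ?_ (abs_nonneg _) (by linarith)
      · exact (abs_sub _ _).trans (add_le_add hv.2 (he1 v.1))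
      · rw [abs_mul, abs_inv]
        refine (mul_le_mul_of_nonneg_left (abs_tilt_add_sub_le hΛ _ _ _)
          (inv_nonneg.2 (abs_nonneg r))).trans (le_of_eq ?_)
        rw [Nuisance.path_q, show (trueNuisance Λ P).q v.1 t = lowerQuantile Λ P v.1 t from rfl,
          add_sub_cancel_left, abs_mul]
        have := abs_pos.2 hr.1
        field_simp
    · rw [abs_mul]
      refine mul_le_mul_of_nonneg_right ?_ (abs_nonneg _)
      refine (abs_sub _ _).trans ?_
      rw [abs_one]
      exact add_le_add_left hv.2 1
  · exact (((hη'.integrable_q.sub iq).abs.const_mul (Λ + 1)).const_mul (C + 1)).add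
      ((hη'.integrable_rho.sub hη.integrable_rho).abs.const_mul (C + 1))
  -- The tilt has its kink where y equals the quantile; without an atom there, differentiability
  -- holds almost everywhere.
  · have hne : ∀ᵐ v ∂(armLaw P t), v.2 ≠ lowerQuantile Λ P v.1 t := by
      have hm : MeasurableSet {v : 𝒳 × ℝ | v.2 ≠ lowerQuantile Λ P v.1 t} :=
        (measurableSet_eq_fun measurable_snd (mq.comp measurable_fst)).compl
      refine Measure.ae_compProd_of_ae_ae hm ?_
      filter_upwards [hatom] with x hx
      rw [outcomeKernel_apply]
      exact (measure_eq_zero_iff_ae_notMem.1 hx).mono fun y hy => hy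
    filter_upwards [ae_armLaw_of_ae hpos, hne] with v h1 h2
    have hr0 : Tendsto (fun r : ℝ => r) l (𝓝 0) := tendsto_id.mono_left nhdsWithin_le_nhds
    have t1 : Tendsto (fun r => armProb P t v.1 / ((trueNuisance Λ P).path η' r).eT t v.1) l
        (𝓝 1) := by
      have : Tendsto (fun r => ((trueNuisance Λ P).path η' r).eT t v.1) l
          (𝓝 (armProb P t v.1)) := by
        simp_rw [Nuisance.path_eT, ← armProb_eq P Λ]
        have := (hr0.mul_const (η'.eT t v.1 - armProb P t v.1)).const_add (armProb P t v.1)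
        simpa using this
      have h := (tendsto_const_nhds (x := armProb P t v.1)).div this (h1 t).ne'
      rwa [div_self (h1 t).ne'] at h
    have t2 : Tendsto (fun r => r⁻¹ * ((tilt Λ v.2 (((trueNuisance Λ P).path η' r).q v.1 t) +
        ((trueNuisance Λ P).path η' r).q v.1 t) -
        (tilt Λ v.2 (lowerQuantile Λ P v.1 t) + lowerQuantile Λ P v.1 t))) l
        (𝓝 (tiltSlope Λ v.2 (lowerQuantile Λ P v.1 t) *
          (η'.q v.1 t - lowerQuantile Λ P v.1 t))) := by
      have hp : HasDerivAt (fun r : ℝ => lowerQuantile Λ P v.1 t +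
          r * (η'.q v.1 t - lowerQuantile Λ P v.1 t))
          (η'.q v.1 t - lowerQuantile Λ P v.1 t) 0 := by
        simpa using ((hasDerivAt_id (0 : ℝ)).mul_const
          (η'.q v.1 t - lowerQuantile Λ P v.1 t)).const_add (lowerQuantile Λ P v.1 t)
      have hd := HasDerivAt.comp (0 : ℝ) (h₂ := fun c => tilt Λ v.2 c + c)
        (by simpa using hasDerivAt_tilt_add hΛ h2) hp
      have hs := hasDerivWithinAt_iff_tendsto_slope.1 (hd.hasDerivWithinAt (s := S))
      refine hs.congr fun r => ?_
      simp [slope_def_field, Nuisance.path_q, trueNuisance, div_eq_inv_mul]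
    have t3 := (((t1.sub_const (armProb P t v.1)).mul t2).sub ((t1.sub_const 1).mul_const
      (η'.rho Λ t v.1 - (trueNuisance Λ P).rho Λ t v.1))).const_mul (policyProb π t v.1)
    refine (t3.congr fun r => ?_).trans (le_of_eq ?_)
    · rfl
    · congr 1; ring

end Orthogonality

/-! ### Neyman orthogonality of the full score -/

section Score

variable {𝒳 : Type*} [MeasurableSpace 𝒳] {Λ : ℝ} {P : Measure (Obs 𝒳)}

lemma integrable_psiW {π : 𝒳 → ℝ} {η : Nuisance 𝒳}
    (h : ∀ t, Integrable (fun z => phi Λ t z η * policyProb π t z.1) P) :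
    Integrable (fun z => psiW Λ z π η) P :=
  integrable_finsetSum _ fun t _ => h t

lemma integral_psiW {π : 𝒳 → ℝ} {η : Nuisance 𝒳}
    (h : ∀ t, Integrable (fun z => phi Λ t z η * policyProb π t z.1) P) :
    ∫ z, psiW Λ z π η ∂P = ∑ t, ∫ z, phi Λ t z η * policyProb π t z.1 ∂P :=
  integral_finsetSum _ fun t _ => h t

variable [IsProbabilityMeasure P]

/-- Continuity of the outcome distribution at its quantile rules out an atom there. -/
lemma ae_measure_quantile_eq_zero (hΛ : 1 ≤ Λ)
    (hpos : ∀ᵐ x ∂(P.map Prod.fst), ∀ t, 0 < armProb P t x)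
    (hcont : ∀ᵐ z ∂P, ContinuousAt (cdf (outcomeLaw P z.1 z.2.2)) (lowerQuantile Λ P z.1 z.2.2)) :
    ∀ᵐ x ∂(P.map Prod.fst), ∀ t, outcomeLaw P x t {lowerQuantile Λ P x t} = 0 := by
  refine ae_covariate_of_ae_arm P hpos
    (p := fun x t => outcomeLaw P x t {lowerQuantile Λ P x t} = 0)
    (hcont.mono fun z hz => measure_singleton_of_continuousAt_cdf _ hz) fun t => ?_
  have hm : MeasurableSet {w : 𝒳 × ℝ | w.2 = lowerQuantile Λ P w.1 t} :=
    measurableSet_eq_fun measurable_snd ((measurable_lowerQuantile P hΛ t).comp measurable_fst)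
  exact Kernel.measurable_kernel_prodMk_left (κ := outcomeKernel P t) hm
    (measurableSet_singleton 0)

/-- Neyman orthogonality along a path on which the propensities stay comparable to the true
ones. -/
lemma hasDerivWithinAt_integral_psiW (hΛ : 1 ≤ Λ)
    (hy : ∀ t, Integrable (fun v : 𝒳 × ℝ => v.2) (armLaw P t))
    (hpos : ∀ᵐ x ∂(P.map Prod.fst), ∀ t, 0 < armProb P t x)
    (hatom : ∀ᵐ x ∂(P.map Prod.fst), ∀ t, outcomeLaw P x t {lowerQuantile Λ P x t} = 0)
    {π : 𝒳 → ℝ} (hπ : Measurable π) (hπ01 : ∀ x, π x ∈ Set.Icc (0 : ℝ) 1)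
    {η' : Nuisance 𝒳} (hη' : η'.Admissible P) {C : ℝ} (hC0 : 0 < C) {S : Set ℝ}
    (h0 : (0 : ℝ) ∈ S)
    (hC : ∀ᶠ r in 𝓝[S] (0 : ℝ), ∀ t, ∀ᵐ x ∂(P.map Prod.fst),
      armProb P t x ≤ C * ((trueNuisance Λ P).path η' r).eT t x) :
    HasDerivWithinAt (fun r => ∫ z, psiW Λ z π ((trueNuisance Λ P).path η' r) ∂P) 0 S 0 := by
  have h1 : ∀ t, HasDerivWithinAt (fun r => ∫ v, policyProb π t v.1 *
      meanScore Λ (armProb P t) ((trueNuisance Λ P).path η' r) t v ∂(armLaw P t)) 0 S 0 := fun t =>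
    hasDerivWithinAt_integral_meanScore hΛ (hy t) hpos (hatom.mono fun x hx => hx t) hπ hπ01
      (hη'.regular t) hC0 (hC.mono fun r hr => hr t)
  have h2 := HasDerivWithinAt.fun_sum (u := Finset.univ) fun t _ => h1 t
  rw [Finset.sum_const_zero] at h2
  have e : ∀ᶠ r in 𝓝[S] (0 : ℝ), ∫ z, psiW Λ z π ((trueNuisance Λ P).path η' r) ∂P =
      ∑ t, ∫ v, policyProb π t v.1 *
        meanScore Λ (armProb P t) ((trueNuisance Λ P).path η' r) t v ∂(armLaw P t) := by
    filter_upwards [hC] with r hr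
    have h3 := fun t => ((regular_trueNuisance hΛ (hy t)).path
      (hη'.regular t) r).integrable_phi hΛ (hy t) hpos hC0 (hr t) hπ hπ01
    rw [integral_psiW fun t => (h3 t).1]
    exact Finset.sum_congr rfl fun t _ => (h3 t).2.2
  exact h2.congr_of_eventuallyEq e (e.self_of_nhdsWithin h0)

lemma integrable_psiW_path (hΛ : 1 ≤ Λ)
    (hy : ∀ t, Integrable (fun v : 𝒳 × ℝ => v.2) (armLaw P t))
    (hpos : ∀ᵐ x ∂(P.map Prod.fst), ∀ t, 0 < armProb P t x)
    {π : 𝒳 → ℝ} (hπ : Measurable π) (hπ01 : ∀ x, π x ∈ Set.Icc (0 : ℝ) 1)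
    {η' : Nuisance 𝒳} (hη' : η'.Admissible P) {C : ℝ} (hC0 : 0 < C) {r : ℝ}
    (hC : ∀ t, ∀ᵐ x ∂(P.map Prod.fst),
      armProb P t x ≤ C * ((trueNuisance Λ P).path η' r).eT t x) :
    Integrable (fun z => psiW Λ z π ((trueNuisance Λ P).path η' r)) P :=
  integrable_psiW fun t => (((regular_trueNuisance hΛ (hy t)).path
    (hη'.regular t) r).integrable_phi hΛ (hy t) hpos hC0 (hC t) hπ hπ01).1

lemma Nuisance.eT_pos {𝒳 : Type*} {η : Nuisance 𝒳} {x : 𝒳} (h : η.e x ∈ Set.Ioo (0 : ℝ) 1)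
    (t : Bool) : 0 < η.eT t x := by
  unfold Nuisance.eT
  split_ifs
  · exact h.1
  · exact sub_pos.2 h.2

/-- The path is a convex combination; dropping its nonnegative part r ẽ_t leaves (1 - r) e_t. -/
lemma armProb_le_path {η' : Nuisance 𝒳} (he : ∀ x, η'.e x ∈ Set.Ioo (0 : ℝ) 1) {r : ℝ}
    (hr : r ∈ Set.Ico (0 : ℝ) 1) (t : Bool) (x : 𝒳) :
    armProb P t x ≤ (1 - r)⁻¹ * ((trueNuisance Λ P).path η' r).eT t x := by
  have h1 : 0 < 1 - r := sub_pos.2 hr.2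
  have h2 := mul_nonneg hr.1 (Nuisance.eT_pos (he x) t).le
  rw [Nuisance.path_eT, ← armProb_eq, ← div_eq_inv_mul, le_div_iff₀ h1]
  linarith

/-- If the path of propensities stays in `(0, 1)` on both sides of `0`, then close to `0` it is
bounded below by half of the true propensity. -/
lemma eventually_armProb_le_path {η' : Nuisance 𝒳} (hm : Measurable η'.e)
    (h : ∀ᶠ r in 𝓝 (0 : ℝ), ∀ᵐ z ∂P,
      ((trueNuisance Λ P).path η' r).e z.1 ∈ Set.Ioo (0 : ℝ) 1) :
    ∀ᶠ r in 𝓝 (0 : ℝ), ∀ t, ∀ᵐ x ∂(P.map Prod.fst),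
      armProb P t x ≤ 2 * ((trueNuisance Λ P).path η' r).eT t x := by
  have h' : ∀ᶠ r in 𝓝 (0 : ℝ), ∀ᵐ x ∂(P.map Prod.fst),
      ((trueNuisance Λ P).path η' r).e x ∈ Set.Ioo (0 : ℝ) 1 := by
    filter_upwards [h] with r hr
    have hm' : Measurable ((trueNuisance Λ P).path η' r).e := by
      have h1 : Measurable (trueNuisance Λ P).e := measurable_armProb P true
      exact h1.add ((hm.sub h1).const_mul r)
    rw [ae_map_iff measurable_fst.aemeasurable (hm' measurableSet_Ioo)]
    exact hr
  obtain ⟨δ, hδ, hball⟩ := Metric.eventually_nhds_iff.1 h'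
  -- The path is affine in r, so positivity at ±δ/2 bounds the increment there by e_t; for |r| < δ/4
  -- the increment is then at most e_t/2. Using two fixed parameters also gives a single null set
  -- for each of them, and hence for all r.
  have hp := hball (y := δ / 2) (by rw [Real.dist_0_eq_abs, abs_of_pos] <;> linarith)
  have hn := hball (y := -(δ / 2)) (by rw [Real.dist_0_eq_abs, abs_neg, abs_of_pos] <;> linarith)
  refine Metric.eventually_nhds_iff.2 ⟨δ / 4, by positivity, fun r hr t => ?_⟩
  rw [Real.dist_0_eq_abs] at hr
  filter_upwards [hp, hn] with x h1 h2
  have h3 := Nuisance.eT_pos h1 t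
  have h4 := Nuisance.eT_pos h2 t
  rw [Nuisance.path_eT, ← armProb_eq] at h3 h4 ⊢
  set d := η'.eT t x - armProb P t x
  have h5 : |δ / 2 * d| ≤ armProb P t x := abs_le.2 ⟨by linarith, by linarith⟩
  have h6 : |r * d| ≤ |δ / 2 * d| / 2 := by
    rw [abs_mul, abs_mul, abs_of_pos (show 0 < δ / 2 by positivity)]
    nlinarith [abs_nonneg d]
  linarith [neg_abs_le (r * d)]

end Score

end RobustPolicy

end

theorem proposition1 {𝒳 : Type*} [MeasurableSpace 𝒳] [StandardBorelSpace 𝒳]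
    (Λ : ℝ) (hΛ : 1 ≤ Λ)
    -- the true law of the full data satisfies the marginal sensitivity model; outcomes have a mean
    {m : ℕ} (Po : Measure (RobustPolicy.Full 𝒳 m)) [IsProbabilityMeasure Po]
    (hMSM : RobustPolicy.IsMSM Λ Po)
    (hY : ∀ a : Bool, Integrable (RobustPolicy.Full.pot a) Po)
    -- the observed-data law
    (P : Measure (RobustPolicy.Obs 𝒳)) [IsProbabilityMeasure P]
    (hP : Po.map RobustPolicy.Full.obs = P)
    -- the dimension of the confounder in the uncertainty set
    (k : ℕ) (hk : 1 ≤ k)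
    -- the policy
    (π : 𝒳 → ℝ) (hπ : Measurable π) (hπ01 : ∀ x, π x ∈ Set.Icc (0 : ℝ) 1) :
    -- (1) identification, with all the expectations and the infimum well defined
    (Integrable (fun z => RobustPolicy.psiW Λ z π (RobustPolicy.trueNuisance Λ P)) P ∧
      (∀ Q ∈ RobustPolicy.uncertaintySet k Λ P,
        Integrable (RobustPolicy.Full.policyOutcome π) Q) ∧
      (RobustPolicy.uncertaintySet k Λ P).Nonempty ∧
      BddBelow ((fun Q : Measure (RobustPolicy.Full 𝒳 k) =>
        ∫ o, RobustPolicy.Full.policyOutcome π o ∂Q) '' RobustPolicy.uncertaintySet k Λ P) ∧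
      ∫ z, RobustPolicy.psiW Λ z π (RobustPolicy.trueNuisance Λ P) ∂P =
        RobustPolicy.worstCaseWelfare k Λ P π) ∧
    -- (2) Neyman orthogonality, if `F(·|x,a)` is continuous at the quantile `q⁻(x,a)`
    ((∀ᵐ z ∂P, ContinuousAt (cdf (RobustPolicy.outcomeLaw P z.1 z.2.2))
        (RobustPolicy.lowerQuantile Λ P z.1 z.2.2)) →
      ∀ η' : RobustPolicy.Nuisance 𝒳, η'.Admissible P →
        -- the derivative at `r = 0` along the segment `0 ≤ r < 1`
        ((∀ r ∈ Set.Ico (0 : ℝ) 1, Integrable (fun z => RobustPolicy.psiW Λ z π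
            ((RobustPolicy.trueNuisance Λ P).path η' r)) P) ∧
          HasDerivWithinAt (fun r : ℝ => ∫ z, RobustPolicy.psiW Λ z π
            ((RobustPolicy.trueNuisance Λ P).path η' r) ∂P) 0 (Set.Ici 0) 0) ∧
        -- the two-sided derivative, if `e + r (e' - e)` takes values in `(0, 1)` for `r` near `0`
        ((∀ᶠ r in 𝓝 (0 : ℝ), ∀ᵐ z ∂P,
            ((RobustPolicy.trueNuisance Λ P).path η' r).e z.1 ∈ Set.Ioo (0 : ℝ) 1) →
          (∀ᶠ r in 𝓝 (0 : ℝ), Integrable (fun z => RobustPolicy.psiW Λ z π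
            ((RobustPolicy.trueNuisance Λ P).path η' r)) P) ∧
          HasDerivAt (fun r : ℝ => ∫ z, RobustPolicy.psiW Λ z π
            ((RobustPolicy.trueNuisance Λ P).path η' r) ∂P) 0 0)) := by
  have hy := fun t => (hMSM.integrable_pot_iff hΛ hP t).1 (hY t)
  have hpos := hMSM.ae_armProb_pos hΛ hP
  have hleast := RobustPolicy.isLeast_armValue (k := k) hΛ hk hpos hy hπ hπ01
  have hphi := fun t => RobustPolicy.integral_phi_trueNuisance hΛ (hy t) hpos hπ hπ01
  refine ⟨⟨RobustPolicy.integrable_psiW fun t => (hphi t).1, ?_, ?_, ⟨_, hleast.2⟩, ?_⟩, ?_⟩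
  · rintro Q ⟨hQ, hM, hPQ⟩
    exact (hM.integral_policyOutcome hΛ hPQ
      (fun t => (hM.integrable_pot_iff hΛ hPQ t).2 (hy t)) hπ hπ01).1
  · obtain ⟨Q, hQ, -⟩ := hleast.1
    exact ⟨Q, hQ⟩
  · rw [RobustPolicy.integral_psiW fun t => (hphi t).1, RobustPolicy.worstCaseWelfare,
      hleast.csInf_eq]
    exact Finset.sum_congr rfl fun t _ => (hphi t).2
  · intro hcont η' hη'
    have hatom := RobustPolicy.ae_measure_quantile_eq_zero hΛ hpos hcont
    refine ⟨⟨fun r hr => ?_, ?_⟩, fun hpath => ⟨?_, ?_⟩⟩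
    · exact RobustPolicy.integrable_psiW_path hΛ hy hpos hπ hπ01 hη'
        (inv_pos.2 (sub_pos.2 hr.2))
        fun t => ae_of_all _ fun x => RobustPolicy.armProb_le_path hη'.e_mem hr t x
    · refine RobustPolicy.hasDerivWithinAt_integral_psiW hΛ hy hpos hatom hπ hπ01 hη'
        (C := 2) two_pos Set.self_mem_Ici ?_
      -- Only small r matter for the derivative: for r < 1/2 the factor (1 - r)⁻¹ is at most 2, a
      -- constant uniform in r.
      filter_upwards [self_mem_nhdsWithin,
        mem_nhdsWithin_of_mem_nhds (gt_mem_nhds (show (0 : ℝ) < 1 / 2 by norm_num))]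
        with r h0 h1 t
      refine ae_of_all _ fun x => ?_
      have h2 : r ∈ Set.Ico (0 : ℝ) 1 := ⟨h0, by linarith⟩
      have h3 := RobustPolicy.armProb_le_path (Λ := Λ) (P := P) hη'.e_mem h2 t x
      have h4 : (1 - r)⁻¹ ≤ 2 := by
        rw [inv_le_comm₀ (by linarith) two_pos]
        linarith
      have h5 : 0 ≤ (RobustPolicy.Nuisance.path (RobustPolicy.trueNuisance Λ P) η' r).eT t x := by
        by_contra hneg
        have := mul_neg_of_pos_of_neg (inv_pos.2 (sub_pos.2 h2.2)) (not_le.1 hneg)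
        linarith [RobustPolicy.armProb_nonneg P t x]
      exact h3.trans (mul_le_mul_of_nonneg_right h4 h5)
    · filter_upwards [RobustPolicy.eventually_armProb_le_path hη'.measurable_e hpath] with r hr
      exact RobustPolicy.integrable_psiW_path hΛ hy hpos hπ hπ01 hη' two_pos hr
    · rw [← hasDerivWithinAt_univ]
      refine RobustPolicy.hasDerivWithinAt_integral_psiW hΛ hy hpos hatom hπ hπ01 hη'
        (C := 2) two_pos (Set.mem_univ _) ?_
      rw [nhdsWithin_univ]
      exact RobustPolicy.eventually_armProb_le_path hη'.measurable_e hpath
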